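/- Let $m\ge 0$ and let $Q:\mathbb R\to\mathbb C^{m\times m}$ satisfy $Q(x)=Q^*(x)$ for almost every $x$ and $\int_{-\infty}^{\infty}(1+|x|)\,|Q_{jk}(x)|\,dx<\infty$ for all $j,k$. Here $^*$ is the conjugate transpose; solutions of $-Y''+Q(x)Y=\rho^2Y$ on $\mathbb R$ are functions $Y$ with $Y,Y'$ locally absolutely continuous that satisfy the equation almost everywhere. For $\operatorname{Im}\rho\ge 0$, $\rho\neq 0$, let $F_\pm(x,\rho)$ be the Jost solutions, i.e. the unique $m\times m$ matrix solutions with $\lim_{x\to\pm\infty}e^{\mp i\rho x}F_\pm(x,\rho)=I_m$. For real $\rho\ne0$ let $A(\rho),B(\rho),C(\rho),D(\rho)$ be the unique $m\times m$ matrices with $$F_+(x,\rho)=F_-(x,-\rho)A(\rho)+F_-(x,\rho)B(\rho),\qquad F_-(x,\rho)=F_+(x,\rho)C(\rho)+F_+(x,-\rho)D(\rho)$$ for all $x$; the matrices $A(\rho)$ and $D(\rho)$ are invertible, and the left and right scattering matrices are $S_-(\rho)=B(\rho)A(\rho)^{-1}$ and $S_+(\rho)=C(\rho)D(\rho)^{-1}$.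 For $\operatorname{Im}\rho>0$ the functions $A$ and $D$ are continued by $$A(\rho)=-\frac1{2i\rho}\bigl(\bar F_-'(x,\rho)F_+(x,\rho)-\bar F_-(x,\rho)F_+'(x,\rho)\bigr),\quad \bar F_-(x,\rho):=F_-(x,-\bar\rho)^*,\qquad D(\rho)=A(-\bar\rho)^*,$$ where the right-hand side of the first formula does not depend on $x$ (it may be taken at $x=0$). Let $\rho_k=i\tau_k$, $\tau_k>0$, run through the points such that $\rho_k^2$ is an eigenvalue, i.e. such that $-Y''+QY=\rho_k^2Y$ has a nonzero vector solution $Y\in L_2(\mathbb R;\mathbb C^m)$. At such a point let $$R_k^-=\lim_{\rho\to\rho_k}(\rho-\rho_k)A(\rho)^{-1},\qquad R_k^+=\lim_{\rho\to\rho_k}(\rho-\rho_k)D(\rho)^{-1},$$ and let the weight matrices $N_k^\pm$ be the unique matrices with $F_+(x,\rho_k)R_k^-=iF_-(x,\rho_k)N_k^-$ and $F_-(x,\rho_k)R_k^+=iF_+(x,\rho_k)N_k^+$ for all $x$. The matrix $N_k^+$ is unitarily diagonalizable, $N_k^+=U^*\operatorname{diag}(d_1,\dots,d_m)\,U$ with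 $U$ unitary and all $d_l\ge0$, and the pseudo-inverse $(N_k^+)^{-1}:=U^*\operatorname{diag}(d_1^{-1},\dots,d_m^{-1})\,U$, with $d_l^{-1}:=0$ where $d_l=0$, does not depend on the choice of this diagonalization. Then all these objects are well defined, as indicated, and $$S_-(\rho)=-D^*(\rho)\,S_+^*(\rho)\,\bigl(D^*(-\rho)\bigr)^{-1}\quad\text{for all real }\rho\ne0,$$ $$N_k^-=R_k^+\,(N_k^+)^{-1}\,(R_k^+)^*\quad\text{for every }k.$$ -/

import Mathlib

open MeasureTheory Filter
open scoped Topology Matrix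

namespace MatrixScattering

noncomputable section

/-- Entrywise derivative `Y'(x)` of a matrix function of a real variable. -/
def matDeriv {m n : ℕ} (Y : ℝ → Matrix (Fin m) (Fin n) ℂ) (x : ℝ) : Matrix (Fin m) (Fin n) ℂ :=
  Matrix.of fun i j => deriv (fun t => Y t i j) x

/-- `Y` solves `-Y'' + Q(x) Y = lam Y` on the line: `Y` is differentiable, and `Y'` is the
(locally absolutely continuous) antiderivative of `Q Y - lam Y`. For locally integrable `Q` this is
the usual notion: `Y`, `Y'` locally absolutely continuous, and the equation holds almost
everywhere. Column vectors are the case `n = 1`. -/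
def IsSolution {m n : ℕ} (Q : ℝ → Matrix (Fin m) (Fin m) ℂ) (lam : ℂ)
    (Y : ℝ → Matrix (Fin m) (Fin n) ℂ) : Prop :=
  (∀ i j, Differentiable ℝ fun t => Y t i j) ∧
    ∀ (a b : ℝ) (i : Fin m) (j : Fin n),
      matDeriv Y b i j - matDeriv Y a i j = ∫ t in a..b, ((Q t * Y t) i j - lam * Y t i j)

/-- The Jost solution at `+∞`: a solution with `exp(-iρx) F(x) → I` as `x → +∞`. -/
def IsJostPlus {m : ℕ} (Q : ℝ → Matrix (Fin m) (Fin m) ℂ) (ρ : ℂ)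
    (F : ℝ → Matrix (Fin m) (Fin m) ℂ) : Prop :=
  IsSolution Q (ρ ^ 2) F ∧
    Tendsto (fun x : ℝ => Complex.exp (-(Complex.I * ρ * x)) • F x) atTop (𝓝 1)

/-- The Jost solution at `-∞`: a solution with `exp(iρx) F(x) → I` as `x → -∞`. -/
def IsJostMinus {m : ℕ} (Q : ℝ → Matrix (Fin m) (Fin m) ℂ) (ρ : ℂ)
    (F : ℝ → Matrix (Fin m) (Fin m) ℂ) : Prop :=
  IsSolution Q (ρ ^ 2) F ∧
    Tendsto (fun x : ℝ => Complex.exp (Complex.I * ρ * x) • F x) atBot (𝓝 1)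

/-- `F₊(·, ρ)`, meaningful for `Im ρ ≥ 0`. -/
def jostPlus {m : ℕ} (Q : ℝ → Matrix (Fin m) (Fin m) ℂ) (ρ : ℂ) :
    ℝ → Matrix (Fin m) (Fin m) ℂ :=
  Classical.epsilon (IsJostPlus Q ρ)

/-- `F₋(·, ρ)`, meaningful for `Im ρ ≥ 0`. -/
def jostMinus {m : ℕ} (Q : ℝ → Matrix (Fin m) (Fin m) ℂ) (ρ : ℂ) :
    ℝ → Matrix (Fin m) (Fin m) ℂ :=
  Classical.epsilon (IsJostMinus Q ρ)

/-- The dual Jost solution `F̄₋(x, ρ) = F₋(x, -ρ̄)*` of `-Z'' + Z Q = ρ² Z`. -/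
def barJostMinus {m : ℕ} (Q : ℝ → Matrix (Fin m) (Fin m) ℂ) (ρ : ℂ) (x : ℝ) :
    Matrix (Fin m) (Fin m) ℂ :=
  (jostMinus Q (-(starRingEnd ℂ ρ)) x)ᴴ

/-- The matrix Wronskian `⟨Z, Y⟩ = Z' Y - Z Y'` at the point `x`. -/
def wronskian {m : ℕ} (Z Y : ℝ → Matrix (Fin m) (Fin m) ℂ) (x : ℝ) : Matrix (Fin m) (Fin m) ℂ :=
  matDeriv Z x * Y x - Z x * matDeriv Y x

/-- `p = (A, B)` with `F₊(x, ρ) = F₋(x, -ρ) A + F₋(x, ρ) B` for all `x` (real `ρ ≠ 0`). -/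
def IsLeftCoeffs {m : ℕ} (Q : ℝ → Matrix (Fin m) (Fin m) ℂ) (ρ : ℂ)
    (p : Matrix (Fin m) (Fin m) ℂ × Matrix (Fin m) (Fin m) ℂ) : Prop :=
  ∀ x, jostPlus Q ρ x = jostMinus Q (-ρ) x * p.1 + jostMinus Q ρ x * p.2

/-- `p = (C, D)` with `F₋(x, ρ) = F₊(x, ρ) C + F₊(x, -ρ) D` for all `x` (real `ρ ≠ 0`). -/
def IsRightCoeffs {m : ℕ} (Q : ℝ → Matrix (Fin m) (Fin m) ℂ) (ρ : ℂ)
    (p : Matrix (Fin m) (Fin m) ℂ × Matrix (Fin m) (Fin m) ℂ) : Prop :=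
  ∀ x, jostMinus Q ρ x = jostPlus Q ρ x * p.1 + jostPlus Q (-ρ) x * p.2

/-- `A(ρ)`: the coefficient for real `ρ ≠ 0`, and its continuation
`A(ρ) = -(2iρ)⁻¹ ⟨F̄₋(x, ρ), F₊(x, ρ)⟩` for `Im ρ > 0` (the Wronskian does not depend on `x`). -/
def coeffA {m : ℕ} (Q : ℝ → Matrix (Fin m) (Fin m) ℂ) (ρ : ℂ) : Matrix (Fin m) (Fin m) ℂ :=
  if ρ.im = 0 then (Classical.epsilon (IsLeftCoeffs Q ρ)).1
  else (-(1 / (2 * Complex.I * ρ))) • wronskian (barJostMinus Q ρ) (jostPlus Q ρ) 0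

/-- `B(ρ)`, for real `ρ ≠ 0`. -/
def coeffB {m : ℕ} (Q : ℝ → Matrix (Fin m) (Fin m) ℂ) (ρ : ℂ) : Matrix (Fin m) (Fin m) ℂ :=
  (Classical.epsilon (IsLeftCoeffs Q ρ)).2

/-- `C(ρ)`, for real `ρ ≠ 0`. -/
def coeffC {m : ℕ} (Q : ℝ → Matrix (Fin m) (Fin m) ℂ) (ρ : ℂ) : Matrix (Fin m) (Fin m) ℂ :=
  (Classical.epsilon (IsRightCoeffs Q ρ)).1

/-- `D(ρ)`: the coefficient for real `ρ ≠ 0`, and its continuation `D(ρ) = A(-ρ̄)*` for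
`Im ρ > 0`. -/
def coeffD {m : ℕ} (Q : ℝ → Matrix (Fin m) (Fin m) ℂ) (ρ : ℂ) : Matrix (Fin m) (Fin m) ℂ :=
  if ρ.im = 0 then (Classical.epsilon (IsRightCoeffs Q ρ)).2
  else (coeffA Q (-(starRingEnd ℂ ρ)))ᴴ

/-- The left scattering matrix `S₋(ρ) = B(ρ) A(ρ)⁻¹`. -/
def scatMinus {m : ℕ} (Q : ℝ → Matrix (Fin m) (Fin m) ℂ) (ρ : ℂ) : Matrix (Fin m) (Fin m) ℂ :=
  coeffB Q ρ * (coeffA Q ρ)⁻¹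

/-- The right scattering matrix `S₊(ρ) = C(ρ) D(ρ)⁻¹`. -/
def scatPlus {m : ℕ} (Q : ℝ → Matrix (Fin m) (Fin m) ℂ) (ρ : ℂ) : Matrix (Fin m) (Fin m) ℂ :=
  coeffC Q ρ * (coeffD Q ρ)⁻¹

/-- `lam` is an eigenvalue: the equation has a nonzero vector solution in `L₂(ℝ; ℂᵐ)`. -/
def IsEigenvalue {m : ℕ} (Q : ℝ → Matrix (Fin m) (Fin m) ℂ) (lam : ℂ) : Prop :=
  ∃ Y : ℝ → Matrix (Fin m) (Fin 1) ℂ,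
    IsSolution Q lam Y ∧ Y ≠ 0 ∧ ∀ i, MemLp (fun x => Y x i 0) 2 volume

/-- `R` is the residue of `A⁻¹` at (the at most simple pole) `ρk`. -/
def IsResMinus {m : ℕ} (Q : ℝ → Matrix (Fin m) (Fin m) ℂ) (ρk : ℂ)
    (R : Matrix (Fin m) (Fin m) ℂ) : Prop :=
  Tendsto (fun ρ : ℂ => (ρ - ρk) • (coeffA Q ρ)⁻¹) (𝓝[≠] ρk) (𝓝 R)

/-- `R` is the residue of `D⁻¹` at (the at most simple pole) `ρk`. -/
def IsResPlus {m : ℕ} (Q : ℝ → Matrix (Fin m) (Fin m) ℂ) (ρk : ℂ)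
    (R : Matrix (Fin m) (Fin m) ℂ) : Prop :=
  Tendsto (fun ρ : ℂ => (ρ - ρk) • (coeffD Q ρ)⁻¹) (𝓝[≠] ρk) (𝓝 R)

/-- `R⁻` at `ρk`. -/
def resMinus {m : ℕ} (Q : ℝ → Matrix (Fin m) (Fin m) ℂ) (ρk : ℂ) : Matrix (Fin m) (Fin m) ℂ :=
  Classical.epsilon (IsResMinus Q ρk)

/-- `R⁺` at `ρk`. -/
def resPlus {m : ℕ} (Q : ℝ → Matrix (Fin m) (Fin m) ℂ) (ρk : ℂ) : Matrix (Fin m) (Fin m) ℂ :=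
  Classical.epsilon (IsResPlus Q ρk)

/-- `F₊(x, ρk) R⁻ = i F₋(x, ρk) N` for all `x`. -/
def IsWeightMinus {m : ℕ} (Q : ℝ → Matrix (Fin m) (Fin m) ℂ) (ρk : ℂ)
    (N : Matrix (Fin m) (Fin m) ℂ) : Prop :=
  ∀ x, jostPlus Q ρk x * resMinus Q ρk = Complex.I • (jostMinus Q ρk x * N)

/-- `F₋(x, ρk) R⁺ = i F₊(x, ρk) N` for all `x`. -/
def IsWeightPlus {m : ℕ} (Q : ℝ → Matrix (Fin m) (Fin m) ℂ) (ρk : ℂ)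
    (N : Matrix (Fin m) (Fin m) ℂ) : Prop :=
  ∀ x, jostMinus Q ρk x * resPlus Q ρk = Complex.I • (jostPlus Q ρk x * N)

/-- The left weight matrix `N⁻` at `ρk`. -/
def weightMinus {m : ℕ} (Q : ℝ → Matrix (Fin m) (Fin m) ℂ) (ρk : ℂ) : Matrix (Fin m) (Fin m) ℂ :=
  Classical.epsilon (IsWeightMinus Q ρk)

/-- The right weight matrix `N⁺` at `ρk`. -/
def weightPlus {m : ℕ} (Q : ℝ → Matrix (Fin m) (Fin m) ℂ) (ρk : ℂ) : Matrix (Fin m) (Fin m) ℂ :=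
  Classical.epsilon (IsWeightPlus Q ρk)

/-- `N = U* diag(d) U` with `U` unitary and `d ≥ 0`, and `P = U* diag(d⁻¹) U`, where the zero
entries of `d` stay zero (`0⁻¹ = 0`). The order of the `d l` is immaterial: a permutation can be
absorbed into `U`. -/
def IsPseudoInverse {m : ℕ} (N P : Matrix (Fin m) (Fin m) ℂ) : Prop :=
  ∃ U ∈ Matrix.unitaryGroup (Fin m) ℂ, ∃ d : Fin m → ℝ, (∀ l, 0 ≤ d l) ∧
    N = Uᴴ * Matrix.diagonal (fun l => (d l : ℂ)) * U ∧
    P = Uᴴ * Matrix.diagonal (fun l => (((d l)⁻¹ : ℝ) : ℂ)) * U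

/-- The pseudo-inverse of a positive semidefinite Hermitian matrix. -/
def pseudoInverse {m : ℕ} (N : Matrix (Fin m) (Fin m) ℂ) : Matrix (Fin m) (Fin m) ℂ :=
  Classical.epsilon (IsPseudoInverse N)

end

end MatrixScattering

namespace MatrixScattering

noncomputable section

/-! ### Absolutely continuous primitives of Banach-valued functions -/

section Primitive

set_option linter.unusedSectionVars false

variable {E : Type*} [NormedAddCommGroup E]

/-! The reflection `x ↦ -x` turns `F₋` for `Q` into `F₊` for `Q(-x)`, so the analysis is done at
`+∞` only. For integrable `Q` and `ρ ≠ 0` the amplitude `H = exp(-iρx) F₊` satisfies the Volterra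
equation `H(x) = 1 + ∫_x^∞ (2iρ)⁻¹ (exp(2iρ(t-x)) - 1) Q(t) H(t) dt`. A weighted norm makes the
integral operator a contraction (`isUnit_one_sub_volterra`). This yields existence, holomorphy in
`Im ρ > 0`, and uniqueness (`IsSol.eq_zero_of_tendsto`).

Since `Q` is self-adjoint, the Wronskian `Z'* Y - Z* Y'` of solutions for conjugate spectral
parameters is constant. For real `ρ` the four Wronskians of `F₊(±ρ)` are known from the asymptotics,
so `A, B, C, D` are Wronskians of `F₊` and `F₋` at `0`. Taking adjoints there gives `D(ρ) = A(-ρ̄)*`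
and `C* = -B`, and the self-Wronskian of `F₋` gives `D*D = 1 + C*C`, hence invertibility. The
scattering formula is then algebra: `B A⁻¹ = -C* A⁻¹`, with `C* = D* S₊*` and `A(ρ) = D(-ρ)*`.

At `ρ = iτ`, `A V = 0` holds exactly when `F₊ V = F₋ W` for some `W`, and then `W* A = 0`.
Differentiating in the spectral parameter gives `W* A' V = -i ∫ (F₊V)*(F₊V)` over the line
(`exists_hasDerivAt_transCoeff`). Definiteness of this integral forces the pole of `A⁻¹` to be at
most simple (`exists_residue`). With `R` the residue, `A R = 0` and `R A = 0` give `F₊ R = F₋ W` and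
`F₊ V = F₋ R*` for suitable `W` and `V`. Since `R⁺ = -R*`, this means `N⁻ = -iW` and `N⁺ = iV`. The
same integral identity for the second pair shows that `iV` is positive semidefinite. Finally, with
`T` the pseudo-inverse of `N⁺`, the projection `N⁺T` fixes `R`, so `F₋ R* T R = F₊ V T R = -i F₊ R =
F₋ N⁻`, and `F₋` cancels. -/

theorem intervalIntegrable_of_locallyIntegrable {f : ℝ → E} (hf : LocallyIntegrable f volume)
    (a b : ℝ) : IntervalIntegrable f volume a b :=
  intervalIntegrable_iff.mpr
    ((hf.integrableOn_isCompact isCompact_uIcc).mono_set Set.uIoc_subset_uIcc)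

theorem locallyIntegrable_norm {f : ℝ → E} (hf : LocallyIntegrable f volume) :
    LocallyIntegrable (fun x => ‖f x‖) volume := fun x => (hf x).norm

theorem locallyIntegrable_comp_neg {f : ℝ → E} (hf : LocallyIntegrable f volume) :
    LocallyIntegrable (fun x => f (-x)) volume := by
  rw [locallyIntegrable_iff] at hf ⊢
  intro K hK
  have h := hf _ hK.neg
  rw [← Set.image_neg_eq_neg] at h
  exact (MeasurePreserving.integrableOn_image (Measure.measurePreserving_neg volume)
    (MeasurableEquiv.neg ℝ).measurableEmbedding).mp h

/-- Transfers absolute continuity from a real-valued majorant, in practice the indefinite integral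
of a norm, to a vector-valued function. -/
theorem absolutelyContinuousOnInterval_of_dist_le {F : ℝ → E} {φ : ℝ → ℝ} {a b : ℝ}
    (hφ : AbsolutelyContinuousOnInterval φ a b)
    (h : ∀ x ∈ Set.uIcc a b, ∀ y ∈ Set.uIcc a b, dist (F x) (F y) ≤ dist (φ x) (φ y)) :
    AbsolutelyContinuousOnInterval F a b := by
  rw [absolutelyContinuousOnInterval_iff] at hφ ⊢
  intro ε hε
  obtain ⟨δ, hδ, H⟩ := hφ ε hε
  refine ⟨δ, hδ, fun I hI hs => lt_of_le_of_lt (Finset.sum_le_sum fun i hi => ?_) (H I hI hs)⟩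
  have := hI.1 i hi
  exact h _ this.1 _ this.2

theorem absolutelyContinuousOnInterval_mul {R : Type*} [NormedRing R] {F G : ℝ → R} {a b : ℝ}
    (hF : AbsolutelyContinuousOnInterval F a b) (hG : AbsolutelyContinuousOnInterval G a b) :
    AbsolutelyContinuousOnInterval (fun x => F x * G x) a b := by
  obtain ⟨C, hC⟩ := hF.exists_bound
  obtain ⟨D, hD⟩ := hG.exists_bound
  unfold AbsolutelyContinuousOnInterval at hF hG
  refine squeeze_zero' (Eventually.of_forall fun _ => Finset.sum_nonneg fun _ _ => dist_nonneg)
    (g := fun I => C * (∑ i ∈ Finset.range I.1, dist (G (I.2 i).1) (G (I.2 i).2)) +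
      D * (∑ i ∈ Finset.range I.1, dist (F (I.2 i).1) (F (I.2 i).2))) ?_ ?_
  · filter_upwards [eventually_inf_principal.mpr (Eventually.of_forall fun I hI => hI)] with I hI
    rw [Finset.mul_sum, Finset.mul_sum, ← Finset.sum_add_distrib]
    refine Finset.sum_le_sum fun i hi => ?_
    obtain ⟨hx, hy⟩ := hI.1 i hi
    generalize (I.2 i).1 = x at *
    generalize (I.2 i).2 = y at *
    have e : F x * G x - F y * G y = F x * (G x - G y) + (F x - F y) * G y := by noncomm_ring
    rw [dist_eq_norm, dist_eq_norm, dist_eq_norm, e]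
    refine (norm_add_le _ _).trans (add_le_add ?_ ?_)
    · exact (norm_mul_le _ _).trans (mul_le_mul_of_nonneg_right (hC x hx) (norm_nonneg _))
    · rw [mul_comm D]
      exact (norm_mul_le _ _).trans (mul_le_mul_of_nonneg_left (hD y hy) (norm_nonneg _))
  · simpa using (hG.const_mul C).add (hF.const_mul D)

variable [NormedSpace ℝ E]

theorem absolutelyContinuousOnInterval_integral {f : ℝ → E} {a b c : ℝ}
    (hf : LocallyIntegrable f volume) :
    AbsolutelyContinuousOnInterval (fun x => ∫ t in c..x, f t) a b := by
  have hI := intervalIntegrable_of_locallyIntegrable hf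
  have hN := intervalIntegrable_of_locallyIntegrable (locallyIntegrable_norm hf)
  refine absolutelyContinuousOnInterval_of_dist_le
    ((intervalIntegrable_of_locallyIntegrable (locallyIntegrable_norm hf) a b
      ).absolutelyContinuousOnInterval_intervalIntegral (c := a) (by simp)) fun x hx y hy => ?_
  rw [dist_comm, dist_comm (∫ t in a..x, ‖f t‖), dist_eq_norm, dist_eq_norm,
    intervalIntegral.integral_interval_sub_left (hI _ _) (hI _ _),
    intervalIntegral.integral_interval_sub_left (hN _ _) (hN _ _)]
  exact intervalIntegral.norm_integral_le_abs_integral_norm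

variable [CompleteSpace E]

/-- Subtracting the indefinite integral of `f` leaves an absolutely continuous function with zero
derivative almost everywhere, hence a constant. -/
theorem sub_eq_integral_of_ae_hasDerivAt {F f : ℝ → E} {a b : ℝ}
    (hF : AbsolutelyContinuousOnInterval F a b) (hf : LocallyIntegrable f volume)
    (hd : ∀ᵐ x, HasDerivAt F (f x) x) : F b - F a = ∫ t in a..b, f t := by
  have h1 : AbsolutelyContinuousOnInterval (F - fun x => ∫ t in a..x, f t) a b :=
    hF.sub (absolutelyContinuousOnInterval_integral hf)
  obtain ⟨C, hC⟩ := h1.const_of_ae_hasDerivAt_zero (by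
    filter_upwards [hd, LocallyIntegrable.ae_hasDerivAt_integral hf] with x h2 h3 _
    simpa using h2.sub (h3 a))
  have ha := hC a (by simp)
  have hb := hC b (by simp)
  simp only [Pi.sub_apply, intervalIntegral.integral_same, sub_zero] at ha hb
  rw [ha, ← hb]
  abel

/-- `F` is an absolutely continuous antiderivative of the locally integrable function `f`. -/
structure IsPrimitive (F f : ℝ → E) : Prop where
  locallyIntegrable : LocallyIntegrable f volume
  sub_eq : ∀ a b, F b - F a = ∫ t in a..b, f t

namespace IsPrimitive

variable {F f G g : ℝ → E}

theorem intervalIntegrable (h : IsPrimitive F f) (a b : ℝ) : IntervalIntegrable f volume a b :=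
  intervalIntegrable_of_locallyIntegrable h.locallyIntegrable a b

theorem intervalIntegrable_norm (h : IsPrimitive F f) (a b : ℝ) :
    IntervalIntegrable (fun x => ‖f x‖) volume a b := (h.intervalIntegrable a b).norm

theorem eq_add (h : IsPrimitive F f) (a : ℝ) : F = fun x => (∫ t in a..x, f t) + F a := by
  funext x
  rw [← h.sub_eq a x]
  abel

theorem ae_hasDerivAt (h : IsPrimitive F f) : ∀ᵐ x, HasDerivAt F (f x) x := by
  filter_upwards [LocallyIntegrable.ae_hasDerivAt_integral h.locallyIntegrable] with x hx
  rw [h.eq_add 0]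
  exact (hx 0).add_const _

theorem absolutelyContinuous (h : IsPrimitive F f) (a b : ℝ) :
    AbsolutelyContinuousOnInterval F a b := by
  refine absolutelyContinuousOnInterval_of_dist_le
    ((h.intervalIntegrable_norm a b
      ).absolutelyContinuousOnInterval_intervalIntegral (c := a) (by simp)) fun x hx y hy => ?_
  rw [dist_comm, dist_comm (∫ t in a..x, ‖f t‖), dist_eq_norm, dist_eq_norm, h.sub_eq,
    intervalIntegral.integral_interval_sub_left (h.intervalIntegrable_norm _ _)
      (h.intervalIntegrable_norm _ _)]
  exact intervalIntegral.norm_integral_le_abs_integral_norm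

theorem continuous (h : IsPrimitive F f) : Continuous F := by
  rw [h.eq_add 0]
  exact (intervalIntegral.continuous_primitive
    h.intervalIntegrable 0).add continuous_const

theorem hasDerivAt (h : IsPrimitive F f) (hf : Continuous f) (x : ℝ) : HasDerivAt F (f x) x := by
  rw [h.eq_add 0]
  exact (intervalIntegral.integral_hasDerivAt_right (hf.intervalIntegrable 0 x)
    hf.aestronglyMeasurable.stronglyMeasurableAtFilter hf.continuousAt).add_const _

theorem of_hasDerivAt (hF : ∀ x, HasDerivAt F (f x) x) (hf : Continuous f) : IsPrimitive F f :=
  ⟨hf.locallyIntegrable, fun a b => (intervalIntegral.integral_eq_sub_of_hasDerivAt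
    (fun x _ => hF x) (hf.intervalIntegrable a b)).symm⟩

theorem add (hF : IsPrimitive F f) (hG : IsPrimitive G g) :
    IsPrimitive (fun x => F x + G x) (fun x => f x + g x) := by
  refine ⟨hF.locallyIntegrable.add hG.locallyIntegrable, fun a b => ?_⟩
  rw [intervalIntegral.integral_add (hF.intervalIntegrable _ _)
    (hG.intervalIntegrable _ _), ← hF.sub_eq, ← hG.sub_eq]
  abel

theorem neg (hF : IsPrimitive F f) : IsPrimitive (fun x => -F x) (fun x => -f x) := by
  refine ⟨hF.locallyIntegrable.neg, fun a b => ?_⟩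
  rw [intervalIntegral.integral_neg, ← hF.sub_eq]
  abel

theorem sub (hF : IsPrimitive F f) (hG : IsPrimitive G g) :
    IsPrimitive (fun x => F x - G x) (fun x => f x - g x) := by
  simpa only [sub_eq_add_neg] using hF.add hG.neg

theorem const (c : E) : IsPrimitive (fun _ => c) (fun _ => (0 : E)) :=
  ⟨continuous_const.locallyIntegrable, by simp⟩

theorem congr_ae (hF : IsPrimitive F f) (h : f =ᵐ[volume] g) : IsPrimitive F g := by
  refine ⟨hF.locallyIntegrable.congr h, fun a b => ?_⟩
  rw [hF.sub_eq]
  exact intervalIntegral.integral_congr_ae (h.mono fun x hx _ => hx)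

theorem comp_neg (hF : IsPrimitive F f) :
    IsPrimitive (fun x => F (-x)) (fun x => -f (-x)) := by
  refine ⟨(locallyIntegrable_comp_neg hF.locallyIntegrable).neg, fun a b => ?_⟩
  · rw [intervalIntegral.integral_neg, intervalIntegral.integral_comp_neg, ← hF.sub_eq]
    abel

end IsPrimitive

theorem locallyIntegrable_continuous_mul {R : Type*} [NormedRing R] {F g : ℝ → R}
    (hF : Continuous F) (hg : LocallyIntegrable g volume) :
    LocallyIntegrable (fun x => F x * g x) volume := by
  rw [locallyIntegrable_iff] at hg ⊢
  intro K hK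
  exact (hg K hK).continuousOn_mul hF.continuousOn hK

theorem locallyIntegrable_mul_continuous {R : Type*} [NormedRing R] {F g : ℝ → R}
    (hF : Continuous F) (hg : LocallyIntegrable g volume) :
    LocallyIntegrable (fun x => g x * F x) volume := by
  rw [locallyIntegrable_iff] at hg ⊢
  intro K hK
  exact (hg K hK).mul_continuousOn hF.continuousOn hK

/-- Product rule for factors that are differentiable only almost everywhere, as `Y'` is for a
solution `Y`; Wronskians are differentiated with it. -/
theorem IsPrimitive.mul {R : Type*} [NormedRing R] [NormedAlgebra ℝ R] [CompleteSpace R]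
    {F f G g : ℝ → R} (hF : IsPrimitive F f) (hG : IsPrimitive G g) :
    IsPrimitive (fun x => F x * G x) (fun x => f x * G x + F x * g x) := by
  have hl : LocallyIntegrable (fun x => f x * G x + F x * g x) volume :=
    (locallyIntegrable_mul_continuous hG.continuous hF.locallyIntegrable).add
      (locallyIntegrable_continuous_mul hF.continuous hG.locallyIntegrable)
  refine ⟨hl, fun a b => sub_eq_integral_of_ae_hasDerivAt (F := fun x => F x * G x)
    (absolutelyContinuousOnInterval_mul
    (hF.absolutelyContinuous a b) (hG.absolutelyContinuous a b)) hl ?_⟩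
  filter_upwards [hF.ae_hasDerivAt, hG.ae_hasDerivAt] with x h1 h2
  exact h1.mul h2

theorem IsPrimitive.exp {F f : ℝ → ℝ} (hF : IsPrimitive F f) :
    IsPrimitive (fun x => Real.exp (F x)) (fun x => Real.exp (F x) * f x) := by
  have hl : LocallyIntegrable (fun x => Real.exp (F x) * f x) volume :=
    locallyIntegrable_continuous_mul (Real.continuous_exp.comp hF.continuous) hF.locallyIntegrable
  refine ⟨hl, fun a b => sub_eq_integral_of_ae_hasDerivAt
    (F := fun x => Real.exp (F x)) ?_ hl ?_⟩
  -- With `C` a bound for `|F|` on the interval, `exp` is Lipschitz on `(-∞, C]` with constant `exp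
  -- C`.
  · obtain ⟨C, hC⟩ := (hF.absolutelyContinuous a b).exists_bound
    refine absolutelyContinuousOnInterval_of_dist_le
      ((hF.absolutelyContinuous a b).const_mul (Real.exp C)) fun x hx y hy => ?_
    simp only [Real.dist_eq]
    rw [← mul_sub, abs_mul, abs_of_pos (Real.exp_pos C)]
    have key := Convex.norm_image_sub_le_of_norm_deriv_le (f := Real.exp) (s := Set.Iic C)
      (C := Real.exp C) (fun z _ => Real.differentiableAt_exp) (fun z hz => by
        rw [Real.deriv_exp, Real.norm_eq_abs, abs_of_pos (Real.exp_pos z)]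
        exact Real.exp_le_exp.mpr hz) (convex_Iic C)
      (show F y ∈ Set.Iic C from (le_abs_self _).trans (hC y hy))
      (show F x ∈ Set.Iic C from (le_abs_self _).trans (hC x hx))
    exact key
  · filter_upwards [hF.ae_hasDerivAt] with x h1
    exact h1.exp

end Primitive

/-! ### The Volterra equation in weighted norms -/

section Volterra

set_option linter.unusedSectionVars false

open scoped BoundedContinuousFunction

variable {R : Type*} [NormedRing R] [NormedAlgebra ℂ R] [CompleteSpace R]

/-- The integral of the norm of `q` over `(x, ∞)`. -/
def tailNorm (q : ℝ → R) (x : ℝ) : ℝ := ∫ t in Set.Ioi x, ‖q t‖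

variable {q : ℝ → R}

theorem isPrimitive_tailNorm (hq : Integrable q) :
    IsPrimitive (tailNorm q) (fun x => -‖q x‖) := by
  refine ⟨hq.norm.neg.locallyIntegrable, fun a b => ?_⟩
  rw [intervalIntegral.integral_neg, ← intervalIntegral.integral_Ioi_sub_Ioi'
    hq.norm.integrableOn hq.norm.integrableOn]
  simp [tailNorm]

theorem tailNorm_nonneg (q : ℝ → R) (x : ℝ) : 0 ≤ tailNorm q x :=
  integral_nonneg fun _ => norm_nonneg _

theorem tailNorm_le (hq : Integrable q) (x : ℝ) : tailNorm q x ≤ ∫ t, ‖q t‖ :=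
  setIntegral_le_integral hq.norm (Eventually.of_forall fun _ => norm_nonneg _)

theorem tendsto_tailNorm (hq : Integrable q) : Tendsto (tailNorm q) atTop (𝓝 0) := by
  have h1 := intervalIntegral_tendsto_integral_Ioi (μ := volume) (0 : ℝ) hq.norm.integrableOn
    tendsto_id
  have h2 : ∀ x, tailNorm q x = tailNorm q 0 - ∫ t in (0 : ℝ)..x, ‖q t‖ := fun x => by
    have := (isPrimitive_tailNorm hq).sub_eq 0 x
    rw [intervalIntegral.integral_neg] at this
    linarith
  have h3 := h1.const_sub (tailNorm q 0)
  rw [show (∫ t in Set.Ioi (0 : ℝ), ‖q t‖) = tailNorm q 0 from rfl, sub_self] at h3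
  exact h3.congr fun x => (h2 x).symm

theorem integrable_norm_mul_exp (hq : Integrable q) (K : ℝ) :
    Integrable (fun t => ‖q t‖ * Real.exp (K * tailNorm q t)) := by
  have hc : Continuous (tailNorm q) := (isPrimitive_tailNorm hq).continuous
  refine hq.norm.mul_bdd (c := Real.exp (|K| * ∫ t, ‖q t‖)) (by fun_prop)
    (Eventually.of_forall fun t => ?_)
  rw [Real.norm_eq_abs, Real.abs_exp]
  exact Real.exp_le_exp.mpr (mul_le_mul (le_abs_self K) (tailNorm_le hq t)
    (tailNorm_nonneg q t) (abs_nonneg K))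

/-- The integrand is the derivative of `-K⁻¹ exp (K * tailNorm q)`, so over `[x, b]` only a
nonnegative boundary term at `b` is discarded. -/
theorem integral_norm_mul_exp_le (hq : Integrable q) {K : ℝ} (hK : 0 < K) (x : ℝ) :
    ∫ t in Set.Ioi x, ‖q t‖ * Real.exp (K * tailNorm q t) ≤
      K⁻¹ * Real.exp (K * tailNorm q x) := by
  have hp := ((IsPrimitive.const K).mul (isPrimitive_tailNorm hq)).exp
  refine le_of_tendsto (intervalIntegral_tendsto_integral_Ioi x
    (integrable_norm_mul_exp hq K).integrableOn tendsto_id) (Eventually.of_forall fun b => ?_)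
  have h := hp.sub_eq x b
  have e : (fun t => Real.exp (K * tailNorm q t) * (0 * tailNorm q t + K * -‖q t‖)) =
      fun t => (-K) * (‖q t‖ * Real.exp (K * tailNorm q t)) := by
    funext t; ring
  rw [e, intervalIntegral.integral_const_mul] at h
  have hb := Real.exp_pos (K * tailNorm q b)
  rw [id, ← sub_nonneg]
  have e2 : K⁻¹ * Real.exp (K * tailNorm q x) -
      ∫ t in x..b, ‖q t‖ * Real.exp (K * tailNorm q t) =
      K⁻¹ * Real.exp (K * tailNorm q b) := by
    rw [← sub_eq_zero]
    have : K * (K⁻¹ * Real.exp (K * tailNorm q x) -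
      (∫ t in x..b, ‖q t‖ * Real.exp (K * tailNorm q t)) -
      K⁻¹ * Real.exp (K * tailNorm q b)) = 0 := by
      field_simp
      linarith
    exact (mul_eq_zero.mp this).resolve_left hK.ne'
  rw [e2]
  positivity

theorem integrable_kernel_smul (hq : Integrable q) (κ : ℝ →ᵇ ℂ) (H : ℝ →ᵇ R) (x : ℝ) :
    Integrable (fun t => κ (t - x) • (q t * H t)) := by
  refine Integrable.bdd_smul (C := ‖κ‖) ?_ ?_ (Eventually.of_forall fun t => κ.norm_coe_le_norm _)
  · exact hq.mul_bdd H.continuous.aestronglyMeasurable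
      (Eventually.of_forall fun t => H.norm_coe_le_norm t)
  · exact (κ.continuous.comp (continuous_id.sub continuous_const)).aestronglyMeasurable

/-- The Volterra integral `∫_x^∞ κ(t - x) q(t) H(t) dt`. -/
def volterraFun (q : ℝ → R) (κ : ℝ →ᵇ ℂ) (H : ℝ →ᵇ R) (x : ℝ) : R :=
  ∫ t in Set.Ioi x, κ (t - x) • (q t * H t)

theorem norm_volterraFun_le (hq : Integrable q) (κ : ℝ →ᵇ ℂ) (H : ℝ →ᵇ R) (x : ℝ) :
    ‖volterraFun q κ H x‖ ≤ ‖κ‖ * ‖H‖ * tailNorm q x := by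
  rw [tailNorm, ← integral_const_mul]
  refine norm_integral_le_of_norm_le (hq.norm.const_mul _).integrableOn
    (Eventually.of_forall fun t => ?_)
  calc ‖κ (t - x) • (q t * H t)‖ ≤ ‖κ (t - x)‖ * (‖q t‖ * ‖H t‖) :=
        (norm_smul_le _ _).trans (mul_le_mul_of_nonneg_left (norm_mul_le _ _) (norm_nonneg _))
    _ ≤ ‖κ‖ * (‖q t‖ * ‖H‖) := by
        gcongr
        · exact κ.norm_coe_le_norm _
        · exact H.norm_coe_le_norm _
    _ = ‖κ‖ * ‖H‖ * ‖q t‖ := by ring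

theorem continuous_volterraFun (hq : Integrable q) (κ : ℝ →ᵇ ℂ) (H : ℝ →ᵇ R) :
    Continuous (volterraFun q κ H) := by
  have e : volterraFun q κ H =
      fun x => ∫ t, (Set.Ioi x).indicator (fun t => κ (t - x) • (q t * H t)) t := by
    funext x
    rw [integral_indicator measurableSet_Ioi, volterraFun]
  rw [e, continuous_iff_continuousAt]
  intro x₀
  refine continuousAt_of_dominated (bound := fun t => ‖κ‖ * ‖H‖ * ‖q t‖)
    (Eventually.of_forall fun x =>
      ((integrable_kernel_smul hq κ H x).indicator measurableSet_Ioi).aestronglyMeasurable)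
    (Eventually.of_forall fun x => Eventually.of_forall fun t => ?_) (hq.norm.const_mul _) ?_
  · refine (norm_indicator_le_norm_self _ _).trans ?_
    calc ‖κ (t - x) • (q t * H t)‖ ≤ ‖κ (t - x)‖ * (‖q t‖ * ‖H t‖) :=
          (norm_smul_le _ _).trans (mul_le_mul_of_nonneg_left (norm_mul_le _ _) (norm_nonneg _))
      _ ≤ ‖κ‖ * (‖q t‖ * ‖H‖) := by
          gcongr
          · exact κ.norm_coe_le_norm _
          · exact H.norm_coe_le_norm _
      _ = ‖κ‖ * ‖H‖ * ‖q t‖ := by ring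
  -- For fixed `t` the integrand jumps in `x` only at `x = t`, so continuity at `x₀` can fail only
  -- for `t = x₀`.
  · have : ∀ᵐ t : ℝ, t ≠ x₀ := by simp [ae_iff, measure_singleton]
    filter_upwards [this] with t ht
    rcases lt_or_gt_of_ne ht with h | h
    · refine (continuousAt_const (y := (0 : R))).congr ?_
      filter_upwards [lt_mem_nhds h] with x hx
      simp [hx.le]
    · have hc : ContinuousAt (fun x => κ (t - x) • (q t * H t)) x₀ := by
        exact ((κ.continuous.comp (continuous_const.sub continuous_id)).smul
          continuous_const).continuousAt
      refine hc.congr ?_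
      filter_upwards [gt_mem_nhds h] with x hx
      simp [Set.indicator, hx]

/-- `volterraFun` as a bounded continuous function. -/
def volterraBCF (hq : Integrable q) (κ : ℝ →ᵇ ℂ) (H : ℝ →ᵇ R) : ℝ →ᵇ R :=
  BoundedContinuousFunction.ofNormedAddCommGroup (volterraFun q κ H)
    (continuous_volterraFun hq κ H) (‖κ‖ * ‖H‖ * ∫ t, ‖q t‖) fun x =>
      (norm_volterraFun_le hq κ H x).trans
        (mul_le_mul_of_nonneg_left (tailNorm_le hq x) (by positivity))

/-- The Volterra operator as a bounded bilinear map of the kernel and the argument. -/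
def volterra (hq : Integrable q) : (ℝ →ᵇ ℂ) →L[ℂ] (ℝ →ᵇ R) →L[ℂ] (ℝ →ᵇ R) :=
  LinearMap.mkContinuous₂
    (LinearMap.mk₂ ℂ (volterraBCF hq)
      (fun κ κ' H => by
        ext x
        simp only [volterraBCF, BoundedContinuousFunction.coe_add, Pi.add_apply,
          BoundedContinuousFunction.coe_ofNormedAddCommGroup, volterraFun, add_smul]
        exact integral_add (integrable_kernel_smul hq κ H x).integrableOn
          (integrable_kernel_smul hq κ' H x).integrableOn)
      (fun c κ H => by
        ext x
        simp only [volterraBCF, BoundedContinuousFunction.coe_smul, smul_assoc,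
          BoundedContinuousFunction.coe_ofNormedAddCommGroup, volterraFun]
        exact integral_smul c _)
      (fun κ H H' => by
        ext x
        simp only [volterraBCF, BoundedContinuousFunction.coe_add, Pi.add_apply,
          BoundedContinuousFunction.coe_ofNormedAddCommGroup, volterraFun, mul_add, smul_add]
        exact integral_add (integrable_kernel_smul hq κ H x).integrableOn
          (integrable_kernel_smul hq κ H' x).integrableOn)
      (fun c κ H => by
        ext x
        simp only [volterraBCF, BoundedContinuousFunction.coe_smul, mul_smul_comm,
          BoundedContinuousFunction.coe_ofNormedAddCommGroup, volterraFun]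
        rw [← integral_smul]
        congr 1
        funext t
        rw [smul_comm]))
    (∫ t, ‖q t‖) fun κ H => by
      have h0 : 0 ≤ ∫ t, ‖q t‖ := integral_nonneg fun _ => norm_nonneg _
      refine (BoundedContinuousFunction.norm_ofNormedAddCommGroup_le
        (continuous_volterraFun hq κ H) (C := ‖κ‖ * ‖H‖ * ∫ t, ‖q t‖) (by positivity)
        fun x => (norm_volterraFun_le hq κ H x).trans
        (mul_le_mul_of_nonneg_left (tailNorm_le hq x) (by positivity))).trans
        (le_of_eq ?_)
      ring

theorem volterra_apply (hq : Integrable q) (κ : ℝ →ᵇ ℂ) (H : ℝ →ᵇ R) (x : ℝ) :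
    volterra hq κ H x = ∫ t in Set.Ioi x, κ (t - x) • (q t * H t) := rfl

/-- Multiplication by a bounded continuous scalar function. -/
def mulBCF (R : Type*) [NormedRing R] [NormedAlgebra ℂ R] (w : ℝ →ᵇ ℂ) :
    (ℝ →ᵇ R) →L[ℂ] (ℝ →ᵇ R) :=
  LinearMap.mkContinuous
    { toFun := fun H => w • H
      map_add' := fun H H' => smul_add w H H'
      map_smul' := fun c H => by
        ext x
        exact smul_comm (w x) c (H x) } ‖w‖ fun H => norm_smul_le w H

theorem mulBCF_apply (w : ℝ →ᵇ ℂ) (H : ℝ →ᵇ R) (x : ℝ) : mulBCF R w H x = w x • H x := rfl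

/-- The weight `exp (K * tailNorm q)`. -/
def weight (hq : Integrable q) (K : ℝ) : ℝ →ᵇ ℂ :=
  BoundedContinuousFunction.ofNormedAddCommGroup
    (fun x => (Real.exp (K * tailNorm q x) : ℂ))
    (by
      have hc : Continuous (tailNorm q) := (isPrimitive_tailNorm hq).continuous
      fun_prop) (Real.exp (|K| * ∫ t, ‖q t‖)) fun x => by
      rw [Complex.norm_real, Real.norm_eq_abs, Real.abs_exp]
      exact Real.exp_le_exp.mpr (mul_le_mul (le_abs_self K) (tailNorm_le hq x)
        (tailNorm_nonneg q x) (abs_nonneg K))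

theorem weight_apply (hq : Integrable q) (K x : ℝ) :
    weight hq K x = (Real.exp (K * tailNorm q x) : ℂ) := rfl

theorem mulBCF_weight_mul (hq : Integrable q) (K : ℝ) :
    mulBCF R (weight hq K) * mulBCF R (weight hq (-K)) = 1 := by
  ext H x
  simp only [mul_apply_eq_comp, mulBCF_apply, weight_apply, smul_smul,
    one_apply_eq_self]
  rw [← Complex.ofReal_mul, ← Real.exp_add]
  simp

/-- Conjugation by the weight `exp (K * tailNorm q)` brings the norm of the operator down to `‖κ‖ /
K`, by `integral_norm_mul_exp_le`. For large `K` the Neumann series applies, whatever the size of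
`q`. -/
theorem isUnit_one_sub_volterra (hq : Integrable q) (κ : ℝ →ᵇ ℂ) :
    IsUnit ((1 : (ℝ →ᵇ R) →L[ℂ] (ℝ →ᵇ R)) - volterra hq κ) := by
  -- Any `K > ‖κ‖` would do; the summand `1` keeps `K` positive when `κ = 0`.
  set K : ℝ := 2 * ‖κ‖ + 1 with hKdef
  have hK : 0 < K := by positivity
  set M := mulBCF R (weight hq K)
  set N := mulBCF R (weight hq (-K))
  have hMN : M * N = 1 := mulBCF_weight_mul hq K
  have hNM : N * M = 1 := by simpa using mulBCF_weight_mul hq (-K)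
  have hM : IsUnit M := ⟨⟨M, N, hMN, hNM⟩, rfl⟩
  have hN : IsUnit N := ⟨⟨N, M, hNM, hMN⟩, rfl⟩
  have hS : ‖N * volterra hq κ * M‖ ≤ ‖κ‖ * K⁻¹ := by
    refine ContinuousLinearMap.opNorm_le_bound _ (by positivity) fun H => ?_
    refine (BoundedContinuousFunction.norm_le (by positivity)).mpr fun x => ?_
    rw [mul_apply_eq_comp, mul_apply_eq_comp, mulBCF_apply,
      volterra_apply, weight_apply, norm_smul, Complex.norm_real, Real.norm_eq_abs, Real.abs_exp]
    have h1 : ‖∫ t in Set.Ioi x, κ (t - x) • (q t * M H t)‖ ≤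
        ∫ t in Set.Ioi x, ‖κ‖ * ‖H‖ * (‖q t‖ * Real.exp (K * tailNorm q t)) := by
      refine norm_integral_le_of_norm_le ((integrable_norm_mul_exp hq K).const_mul _).integrableOn
        (Eventually.of_forall fun t => ?_)
      have hMH : ‖M H t‖ ≤ Real.exp (K * tailNorm q t) * ‖H‖ := by
        rw [mulBCF_apply, weight_apply, norm_smul, Complex.norm_real, Real.norm_eq_abs,
          Real.abs_exp]
        exact mul_le_mul_of_nonneg_left (H.norm_coe_le_norm t) (Real.exp_pos _).le
      calc ‖κ (t - x) • (q t * M H t)‖ ≤ ‖κ (t - x)‖ * (‖q t‖ * ‖M H t‖) :=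
            (norm_smul_le _ _).trans
              (mul_le_mul_of_nonneg_left (norm_mul_le _ _) (norm_nonneg _))
        _ ≤ ‖κ‖ * (‖q t‖ * (Real.exp (K * tailNorm q t) * ‖H‖)) := by
            gcongr
            exact κ.norm_coe_le_norm _
        _ = ‖κ‖ * ‖H‖ * (‖q t‖ * Real.exp (K * tailNorm q t)) := by ring
    rw [integral_const_mul] at h1
    have h2 := integral_norm_mul_exp_le hq hK x
    calc Real.exp (-K * tailNorm q x) * ‖∫ t in Set.Ioi x, κ (t - x) • (q t * M H t)‖
        ≤ Real.exp (-K * tailNorm q x) *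
          (‖κ‖ * ‖H‖ * (K⁻¹ * Real.exp (K * tailNorm q x))) := by
            gcongr
            exact h1.trans (mul_le_mul_of_nonneg_left h2 (by positivity))
      _ = ‖κ‖ * K⁻¹ * ‖H‖ * (Real.exp (-K * tailNorm q x) * Real.exp (K * tailNorm q x)) := by
            ring
      _ = ‖κ‖ * K⁻¹ * ‖H‖ := by
            rw [← Real.exp_add]
            simp
  have hS1 : ‖N * volterra hq κ * M‖ < 1 := by
    refine hS.trans_lt ?_
    rw [← div_eq_mul_inv, div_lt_one hK]
    linarith [norm_nonneg κ]
  have e : (1 : (ℝ →ᵇ R) →L[ℂ] (ℝ →ᵇ R)) - volterra hq κ = M * (1 - N * volterra hq κ * M) * N := by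
    rw [mul_sub, sub_mul, mul_one, hMN]
    congr 1
    calc volterra hq κ = (M * N) * volterra hq κ * (M * N) := by rw [hMN, one_mul, mul_one]
      _ = _ := by simp only [mul_assoc]
  rw [e]
  have h3 : IsUnit ((1 : (ℝ →ᵇ R) →L[ℂ] (ℝ →ᵇ R)) - N * volterra hq κ * M) :=
    isUnit_one_sub_of_norm_lt_one (R := (ℝ →ᵇ R) →L[ℂ] (ℝ →ᵇ R)) hS1
  exact (hM.mul h3).mul hN

/-- The solution of `H = 1 + volterra κ H`. -/
def volterraSol (hq : Integrable q) (κ : ℝ →ᵇ ℂ) : ℝ →ᵇ R :=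
  Ring.inverse ((1 : (ℝ →ᵇ R) →L[ℂ] (ℝ →ᵇ R)) - volterra hq κ) 1

theorem volterraSol_eq (hq : Integrable q) (κ : ℝ →ᵇ ℂ) :
    volterraSol hq κ = (1 : ℝ →ᵇ R) + volterra hq κ (volterraSol hq κ) := by
  have h := Ring.mul_inverse_cancel _ (isUnit_one_sub_volterra hq κ)
  have h2 := congrArg (fun T : (ℝ →ᵇ R) →L[ℂ] (ℝ →ᵇ R) => T 1) h
  simp only [mul_apply_eq_comp, sub_apply,
    one_apply_eq_self] at h2
  rw [volterraSol]
  exact sub_eq_iff_eq_add.mp h2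

theorem eq_zero_of_volterra_eq_self (hq : Integrable q) (κ : ℝ →ᵇ ℂ) {H : ℝ →ᵇ R}
    (h : volterra hq κ H = H) : H = 0 := by
  have h1 := Ring.inverse_mul_cancel _ (isUnit_one_sub_volterra hq κ)
  have h2 := congrArg (fun T : (ℝ →ᵇ R) →L[ℂ] (ℝ →ᵇ R) => T H) h1
  simpa [h] using h2.symm

/-- The operator is linear in the kernel and inversion is differentiable at units, so holomorphy of
the kernel in sup norm passes to the solution. -/
theorem differentiableAt_volterraSol (hq : Integrable q) {κ : ℂ → ℝ →ᵇ ℂ} {ρ : ℂ}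
    (hκ : DifferentiableAt ℂ κ ρ) :
    DifferentiableAt ℂ (fun z => volterraSol hq (κ z)) ρ := by
  have h1 : DifferentiableAt ℂ (fun z => (1 : (ℝ →ᵇ R) →L[ℂ] (ℝ →ᵇ R)) - volterra hq (κ z)) ρ :=
    DifferentiableAt.const_sub
      (DifferentiableAt.comp ρ (g := fun κ => volterra hq κ) (volterra hq).differentiableAt hκ)
      (1 : (ℝ →ᵇ R) →L[ℂ] (ℝ →ᵇ R))
  have h2 : DifferentiableAt ℂ (fun T : (ℝ →ᵇ R) →L[ℂ] (ℝ →ᵇ R) => Ring.inverse T)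
      ((1 : (ℝ →ᵇ R) →L[ℂ] (ℝ →ᵇ R)) - volterra hq (κ ρ)) :=
    differentiableAt_inverse (𝕜 := ℂ) (R := (ℝ →ᵇ R) →L[ℂ] (ℝ →ᵇ R))
      (isUnit_one_sub_volterra hq (κ ρ))
  have h3 : DifferentiableAt ℂ
      (fun z => Ring.inverse ((1 : (ℝ →ᵇ R) →L[ℂ] (ℝ →ᵇ R)) - volterra hq (κ z))) ρ :=
    DifferentiableAt.comp (𝕜 := ℂ) (E := ℂ) (F := (ℝ →ᵇ R) →L[ℂ] (ℝ →ᵇ R))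
      (G := (ℝ →ᵇ R) →L[ℂ] (ℝ →ᵇ R)) (g := fun T => Ring.inverse T) ρ h2 h1
  exact h3.clm_apply (differentiableAt_const _)

end Volterra

/-! ### Uniqueness of solutions with Jost asymptotics -/

section Jost

open scoped BoundedContinuousFunction

set_option linter.unusedSectionVars false

variable {R : Type*} [NormedRing R] [NormedAlgebra ℂ R] [CompleteSpace R]

theorem IsPrimitive.smul {F f : ℝ → ℂ} {G g : ℝ → R} (hF : IsPrimitive F f)
    (hG : IsPrimitive G g) :
    IsPrimitive (fun x => F x • G x) (fun x => F x • g x + f x • G x) := by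
  have hl : LocallyIntegrable (fun x => F x • g x + f x • G x) volume := by
    refine LocallyIntegrable.add ?_ ?_
    · have := hG.locallyIntegrable
      rw [locallyIntegrable_iff] at this ⊢
      exact fun K hK => (this K hK).continuousOn_smul hF.continuous.continuousOn hK
    · have := hF.locallyIntegrable
      rw [locallyIntegrable_iff] at this ⊢
      exact fun K hK => (this K hK).smul_continuousOn hG.continuous.continuousOn hK
  refine ⟨hl, fun a b => sub_eq_integral_of_ae_hasDerivAt (F := fun x => F x • G x)
    ((hF.absolutelyContinuous a b).smul (hG.absolutelyContinuous a b)) hl ?_⟩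
  filter_upwards [hF.ae_hasDerivAt, hG.ae_hasDerivAt] with x h1 h2
  exact h1.smul h2

theorem IsPrimitive.const_smul {G g : ℝ → R} (c : ℂ) (hG : IsPrimitive G g) :
    IsPrimitive (fun x => c • G x) (fun x => c • g x) := by
  simpa using (IsPrimitive.const c).smul hG

theorem hasDerivAt_cexp_mul (c : ℂ) (x : ℝ) :
    HasDerivAt (fun x : ℝ => Complex.exp (c * x)) (c * Complex.exp (c * x)) x := by
  have h : HasDerivAt (fun x : ℝ => c * (x : ℂ)) c x := by
    simpa using (Complex.ofRealCLM.hasDerivAt (x := x)).const_mul c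
  simpa [mul_comm] using h.cexp

theorem isPrimitive_cexp_mul (c : ℂ) :
    IsPrimitive (fun x : ℝ => Complex.exp (c * x)) (fun x => c * Complex.exp (c * x)) :=
  IsPrimitive.of_hasDerivAt (hasDerivAt_cexp_mul c) (by fun_prop)

theorem IsPrimitive.tendsto_atTop {P p : ℝ → R} (h : IsPrimitive P p) {x : ℝ}
    (hp : IntegrableOn p (Set.Ioi x)) :
    Tendsto P atTop (𝓝 (P x + ∫ t in Set.Ioi x, p t)) := by
  refine ((intervalIntegral_tendsto_integral_Ioi x hp tendsto_id).const_add (P x)).congr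
    fun b => ?_
  rw [id, ← h.sub_eq]
  abel

/-- The increment over a unit step tends to `0`, while by the mean value inequality it stays close
to `c`. -/
theorem eq_zero_of_tendsto_of_hasDerivAt {f f' : ℝ → R} {c : R}
    (hd : ∀ x, HasDerivAt f (f' x) x) (hf : Tendsto f atTop (𝓝 0))
    (hf' : Tendsto f' atTop (𝓝 c)) : c = 0 := by
  by_contra hc
  have hc' : 0 < ‖c‖ := norm_pos_iff.mpr hc
  have h1 : Tendsto (fun x => f (x + 1) - f x) atTop (𝓝 0) := by
    simpa using (hf.comp (tendsto_atTop_add_const_right _ 1 tendsto_id)).sub hf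
  have h2 : ∀ᶠ x in atTop, ‖f (x + 1) - f x‖ < ‖c‖ / 2 := by
    have := h1.norm
    rw [norm_zero] at this
    exact this.eventually_lt_const (by positivity)
  have h3 : ∀ᶠ x in atTop, ‖f' x - c‖ < ‖c‖ / 2 := by
    have := (hf'.sub_const c).norm
    rw [sub_self, norm_zero] at this
    exact this.eventually_lt_const (by positivity)
  obtain ⟨N, hN⟩ := eventually_atTop.mp (h2.and h3)
  have h4 := Convex.norm_image_sub_le_of_norm_hasDerivWithin_le
    (f := fun x => f x - x • c) (f' := fun x => f' x - c) (C := ‖c‖ / 2)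
    (s := Set.Ici N) (x := N) (y := N + 1)
    (fun x _ => by
      have := ((hd x).sub ((hasDerivAt_id x).smul_const c)).hasDerivWithinAt (s := Set.Ici N)
      rwa [one_smul] at this)
    (fun x hx => (hN x hx).2.le) (convex_Ici N) (by simp) (by simp)
  have h5 := (hN N le_rfl).1
  have e : f (N + 1) - (N + 1) • c - (f N - N • c) = (f (N + 1) - f N) - c := by
    rw [add_smul, one_smul]
    abel
  simp only [e, add_sub_cancel_left, norm_one, mul_one] at h4
  have h6 := norm_sub_norm_le c (f (N + 1) - f N)
  rw [norm_sub_rev c] at h6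
  linarith

/-- `Y` solves `-Y'' + q Y = lam Y`, with derivative `Y'`. -/
structure IsSol (q : ℝ → R) (lam : ℂ) (Y Y' : ℝ → R) : Prop where
  hasDerivAt : ∀ x, HasDerivAt Y (Y' x) x
  isPrimitive : IsPrimitive Y' (fun x => q x * Y x - lam • Y x)

namespace IsSol

variable {q : ℝ → R} {lam : ℂ} {Y Y' Z Z' : ℝ → R}

theorem continuous (h : IsSol q lam Y Y') : Continuous Y :=
  continuous_iff_continuousAt.mpr fun x => (h.hasDerivAt x).continuousAt

theorem continuous' (h : IsSol q lam Y Y') : Continuous Y' := h.isPrimitive.continuous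

theorem isPrimitive_self (h : IsSol q lam Y Y') : IsPrimitive Y Y' :=
  IsPrimitive.of_hasDerivAt h.hasDerivAt h.continuous'

theorem sub (h : IsSol q lam Y Y') (h2 : IsSol q lam Z Z') :
    IsSol q lam (fun x => Y x - Z x) (fun x => Y' x - Z' x) := by
  refine ⟨fun x => (h.hasDerivAt x).sub (h2.hasDerivAt x), ?_⟩
  convert! h.isPrimitive.sub h2.isPrimitive using 2 with x
  rw [mul_sub, smul_sub]
  abel

theorem mul_const (h : IsSol q lam Y Y') (c : R) :
    IsSol q lam (fun x => Y x * c) (fun x => Y' x * c) := by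
  refine ⟨fun x => (h.hasDerivAt x).mul_const c, ?_⟩
  convert! h.isPrimitive.mul (IsPrimitive.const c) using 2 with x
  rw [sub_mul, smul_mul_assoc, mul_assoc, mul_zero, add_zero]

theorem comp_neg (h : IsSol q lam Y Y') :
    IsSol (fun x => q (-x)) lam (fun x => Y (-x)) (fun x => -Y' (-x)) := by
  refine ⟨fun x => ?_, ?_⟩
  · have := (h.hasDerivAt (-x)).scomp x (hasDerivAt_neg x)
    rwa [neg_one_smul] at this
  · simpa using h.isPrimitive.comp_neg.neg

end IsSol

/-- The kernel `exp (2iρs)` on `s ≥ 0`, extended to a bounded function on the line. -/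
def expKernel (ρ : ℂ) : ℝ →ᵇ ℂ :=
  BoundedContinuousFunction.ofNormedAddCommGroup
    (fun s => Complex.exp (2 * Complex.I * (⟨ρ.re, max ρ.im 0⟩ : ℂ) * (max s 0 : ℝ)))
    (by fun_prop) 1 fun s => by
      rw [Complex.norm_exp, Real.exp_le_one_iff]
      have h1 : 0 ≤ max ρ.im 0 := le_max_right _ _
      have h2 : 0 ≤ max s 0 := le_max_right _ _
      have := mul_nonneg h1 h2
      simp only [Complex.mul_re, Complex.mul_im, Complex.ofReal_re, Complex.ofReal_im,
        Complex.I_re, Complex.I_im, Complex.re_ofNat, Complex.im_ofNat]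
      linarith

theorem expKernel_apply {ρ : ℂ} (hρ : 0 ≤ ρ.im) {s : ℝ} (hs : 0 ≤ s) :
    expKernel ρ s = Complex.exp (2 * Complex.I * ρ * s) := by
  simp only [expKernel, BoundedContinuousFunction.coe_ofNormedAddCommGroup,
    max_eq_left hρ, max_eq_left hs]

theorem tendsto_volterra {q : ℝ → R} (hq : Integrable q) (κ : ℝ →ᵇ ℂ) (H : ℝ →ᵇ R) :
    Tendsto (fun x => volterra hq κ H x) atTop (𝓝 0) := by
  refine squeeze_zero_norm (norm_volterraFun_le hq κ H) ?_
  simpa using (tendsto_tailNorm hq).const_mul (‖κ‖ * ‖H‖)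

/-- The kernel of the Volterra equation of the normalized Jost solution. -/
def jostKernel (ρ : ℂ) : ℝ →ᵇ ℂ := (2 * Complex.I * ρ)⁻¹ • (expKernel ρ - 1)

/-- With `c ^ 2 = -ρ ^ 2` the equation factors as `(d/dx + c)(d/dx - c) Y = q Y`, and `exp (c x)` is
an integrating factor of the outer operator. The two signs `c = ±iρ` together recover the integral
equation. -/
theorem IsSol.isPrimitive_exp {q : ℝ → R} {ρ : ℂ} {Y Y' : ℝ → R}
    (h : IsSol q (ρ ^ 2) Y Y') {c : ℂ} (hc : c ^ 2 = -ρ ^ 2) :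
    IsPrimitive (fun x : ℝ => Complex.exp (c * x) • (Y' x - c • Y x))
      (fun x : ℝ => Complex.exp (c * x) • (q x * Y x)) := by
  convert! (isPrimitive_cexp_mul c).smul
    (h.isPrimitive.sub (h.isPrimitive_self.const_smul c)) using 2 with x
  have e : ρ ^ 2 = - (c * c) := by rw [← pow_two, hc, neg_neg]
  rw [e]
  module

theorem norm_cexp_le {c : ℂ} (hc : c.re ≤ 0) {a x : ℝ} (hx : a ≤ x) :
    ‖Complex.exp (c * x)‖ ≤ Real.exp (c.re * a) := by
  rw [Complex.norm_exp, Real.exp_le_exp]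
  simp only [Complex.mul_re, Complex.ofReal_re, Complex.ofReal_im, mul_zero, sub_zero]
  exact mul_le_mul_of_nonpos_left hx hc

theorem exists_norm_le_of_tendsto {g : ℝ → R} {l : R} (hg : Continuous g)
    (hl : Tendsto g atTop (𝓝 l)) (a : ℝ) : ∃ C, ∀ x, a ≤ x → ‖g x‖ ≤ C := by
  have h1 : ∀ᶠ x in atTop, ‖g x‖ < ‖l‖ + 1 := hl.norm.eventually_lt_const (by linarith)
  obtain ⟨b, hb⟩ := eventually_atTop.mp h1
  obtain ⟨C, hC⟩ := (isCompact_Icc (a := a) (b := b)).exists_bound_of_continuousOn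
    hg.continuousOn
  refine ⟨max C (‖l‖ + 1), fun x hx => ?_⟩
  rcases le_total x b with h | h
  · exact (hC x ⟨hx, h⟩).trans (le_max_left _ _)
  · exact (hb x h).le.trans (le_max_right _ _)

/-- A solution that is `o(exp (iρx))` at `+∞` vanishes. -/
theorem IsSol.eq_zero_of_tendsto {q : ℝ → R} (hq : Integrable q) {ρ : ℂ} (hρ : 0 ≤ ρ.im)
    (hρ0 : ρ ≠ 0) {Y Y' : ℝ → R} (h : IsSol q (ρ ^ 2) Y Y')
    (hY : Tendsto (fun x : ℝ => Complex.exp (-(Complex.I * ρ * x)) • Y x) atTop (𝓝 0)) (a : ℝ) :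
    Y a = 0 := by
  set g : ℝ → R := fun x => Complex.exp (-(Complex.I * ρ * x)) • Y x with hg
  have hgc : Continuous g := by
    have := h.continuous
    fun_prop
  obtain ⟨C, hC⟩ := exists_norm_le_of_tendsto hgc hY a
  have hC0 : 0 ≤ C := (norm_nonneg _).trans (hC a le_rfl)
  have hI : (Complex.I * ρ) ^ 2 = -ρ ^ 2 := by rw [mul_pow, Complex.I_sq]; ring
  have hP := h.isPrimitive_exp hI
  have hR := h.isPrimitive_exp (c := -(Complex.I * ρ)) (by rw [neg_sq, hI])
  have hre : (Complex.I * ρ).re ≤ 0 := by simpa using hρ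
  have hgY : ∀ x, Y x = Complex.exp (Complex.I * ρ * x) • g x := fun x => by
    rw [hg, smul_smul, ← Complex.exp_add, add_neg_cancel, Complex.exp_zero, one_smul]
  -- the truncated data
  let qa : ℝ → R := (Set.Ioi a).indicator q
  have hqa : Integrable qa := hq.indicator measurableSet_Ioi
  -- `g` may be unbounded to the left of `a`; freezing it there is harmless because `qa` vanishes on
  -- `(-∞, a]`.
  let H : ℝ →ᵇ R := BoundedContinuousFunction.ofNormedAddCommGroup (fun x => g (max x a))
    (hgc.comp (by fun_prop)) C fun x => hC _ (le_max_right _ _)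
  have hqH : ∀ t, a < t → qa t * H t = q t * g t := fun t ht => by
    have h1 : qa t = q t := Set.indicator_of_mem ht q
    have h2 : H t = g t := by simp [H, max_eq_left ht.le]
    rw [h1, h2]
  have hint1 : IntegrableOn (fun t => q t * g t) (Set.Ioi a) := by
    have : Integrable (fun t => qa t * H t) := hqa.mul_bdd H.continuous.aestronglyMeasurable
      (Eventually.of_forall fun t => H.norm_coe_le_norm t)
    exact this.integrableOn.congr_fun (fun t ht => hqH t ht) measurableSet_Ioi
  have hRe : ∀ t : ℝ, Complex.exp (-(Complex.I * ρ) * t) • (q t * Y t) = q t * g t := fun t => by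
    rw [hg, mul_smul_comm, neg_mul]
  have hPe : ∀ t : ℝ, Complex.exp (Complex.I * ρ * t) • (q t * Y t) =
      Complex.exp (2 * Complex.I * ρ * t) • (q t * g t) := fun t => by
    rw [hgY t, mul_smul_comm, smul_smul, ← Complex.exp_add]
    congr 2
    ring
  simp only [hRe] at hR
  simp only [hPe] at hP
  have hre2 : (2 * Complex.I * ρ).re ≤ 0 := by
    rw [mul_assoc]
    simpa using hρ
  have hint2 : IntegrableOn (fun t : ℝ => Complex.exp (2 * Complex.I * ρ * t) • (q t * g t))
      (Set.Ioi a) := by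
    refine Integrable.bdd_smul (C := Real.exp ((2 * Complex.I * ρ).re * a)) hint1
      (Continuous.aestronglyMeasurable
        (f := fun t : ℝ => Complex.exp (2 * Complex.I * ρ * t)) (by fun_prop)) ?_
    refine (ae_restrict_iff' measurableSet_Ioi).mpr (Eventually.of_forall fun t ht => ?_)
    exact norm_cexp_le hre2 (le_of_lt ht)
  have hf0 : Tendsto (fun x : ℝ => Complex.exp (Complex.I * ρ * x) • Y x) atTop (𝓝 0) := by
    refine squeeze_zero_norm' (a := fun x => ‖g x‖) ?_ (by simpa using hY.norm)
    filter_upwards [eventually_ge_atTop 0] with x hx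
    rw [hgY x, smul_smul, ← Complex.exp_add, ← two_mul, ← mul_assoc, ← mul_assoc, norm_smul]
    have := norm_cexp_le hre2 hx
    rw [mul_zero, Real.exp_zero] at this
    exact mul_le_of_le_one_left (norm_nonneg _) this
  have hPlim := hP.tendsto_atTop hint2
  -- The left side has a limit at `+∞` by integrability. As `exp(iρx) Y → 0`, that limit is also the
  -- limit of the derivative of `exp(iρx) Y`, so it is zero.
  have hPx : ∀ x, a ≤ x → Complex.exp (Complex.I * ρ * x) • (Y' x - (Complex.I * ρ) • Y x) =
      - ∫ t in Set.Ioi x, Complex.exp (2 * Complex.I * ρ * t) • (q t * g t) := by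
    intro x hx
    have hl := hP.tendsto_atTop (hint2.mono_set (Set.Ioi_subset_Ioi hx))
    have h0 := eq_zero_of_tendsto_of_hasDerivAt (c := _)
      (f' := fun x : ℝ => Complex.exp (Complex.I * ρ * x) • Y' x +
        (Complex.I * ρ * Complex.exp (Complex.I * ρ * x)) • Y x)
      (fun x => (hasDerivAt_cexp_mul (Complex.I * ρ) x).smul (h.hasDerivAt x)) hf0
      ((hl.add (hf0.const_smul (2 * Complex.I * ρ))).congr fun x => by module)
    rw [smul_zero, add_zero] at h0
    exact eq_neg_of_add_eq_zero_left h0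
  have hvol1 : ∀ x, a ≤ x → volterra hqa (expKernel ρ) H x =
      - Complex.exp (-(Complex.I * ρ) * x) • (Y' x - (Complex.I * ρ) • Y x) := by
    intro x hx
    have e : Complex.exp (-(Complex.I * ρ) * x) • (Y' x - (Complex.I * ρ) • Y x) =
        Complex.exp (-(2 * Complex.I * ρ) * x) •
          (Complex.exp (Complex.I * ρ * x) • (Y' x - (Complex.I * ρ) • Y x)) := by
      rw [smul_smul, ← Complex.exp_add]
      congr 2
      ring
    rw [neg_smul, e, hPx x hx, smul_neg, neg_neg, ← integral_smul, volterra_apply]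
    refine setIntegral_congr_fun measurableSet_Ioi fun t ht => ?_
    have ht' : x < t := ht
    rw [hqH t (lt_of_le_of_lt hx ht'), expKernel_apply hρ (sub_nonneg.mpr ht'.le), smul_smul,
      ← Complex.exp_add]
    congr 2
    push_cast
    ring
  -- Changing the sign in front of `iρ Y` adds `2iρ g`, which tends to `0`, to the quantity just
  -- identified with a Volterra integral. Hence the boundary term at infinity vanishes here too.
  have hRlim : ∀ x, a ≤ x → Complex.exp (-(Complex.I * ρ) * x) •
      (Y' x - (-(Complex.I * ρ)) • Y x) = - ∫ t in Set.Ioi x, q t * g t := by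
    intro x hx
    have hl := hR.tendsto_atTop (hint1.mono_set (Set.Ioi_subset_Ioi hx))
    have hl2 : Tendsto (fun x : ℝ => Complex.exp (-(Complex.I * ρ) * x) •
      (Y' x - (-(Complex.I * ρ)) • Y x)) atTop (𝓝 0) := by
      have h1 := (tendsto_volterra hqa (expKernel ρ) H).neg.add
        (hY.const_smul (2 * Complex.I * ρ))
      rw [neg_zero, smul_zero, add_zero] at h1
      refine h1.congr' ?_
      filter_upwards [eventually_ge_atTop a] with y hy
      rw [hvol1 y hy, neg_mul]
      module
    exact eq_neg_of_add_eq_zero_left (tendsto_nhds_unique hl hl2)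
  have hvol2 : ∀ x, a ≤ x → volterra hqa 1 H x = ∫ t in Set.Ioi x, q t * g t := by
    intro x hx
    rw [volterra_apply]
    refine setIntegral_congr_fun measurableSet_Ioi fun t ht => ?_
    have ht' : x < t := ht
    simp only [BoundedContinuousFunction.coe_one, Pi.one_apply, one_smul]
    exact hqH t (lt_of_le_of_lt hx ht')
  have h2ρ : (2 * Complex.I * ρ) ≠ 0 := by simp [hρ0]
  have hfix : ∀ x, a ≤ x → volterra hqa (jostKernel ρ) H x = g x := by
    intro x hx
    have h1 : volterra hqa (jostKernel ρ) H x = (2 * Complex.I * ρ)⁻¹ •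
        (volterra hqa (expKernel ρ) H x - volterra hqa 1 H x) := by
      simp [jostKernel]
    have h2 := hRlim x hx
    rw [← hvol2 x hx] at h2
    rw [h1, hvol1 x hx, ← neg_eq_iff_eq_neg.mpr h2, inv_smul_eq_iff₀ h2ρ, hg, neg_mul]
    module
  -- `H` itself need not be a fixed point to the left of `a`. Its image agrees with `H` on `[a, ∞)`,
  -- the only place where `qa` can be nonzero, so the image is a fixed point on the whole line.
  have hzero := eq_zero_of_volterra_eq_self hqa (jostKernel ρ)
    (H := volterra hqa (jostKernel ρ) H) (by
      ext x
      rw [volterra_apply, volterra_apply]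
      refine setIntegral_congr_fun measurableSet_Ioi fun t _ => ?_
      rcases le_or_gt t a with ht | ht
      · have : qa t = 0 := Set.indicator_of_notMem (by simpa using ht) q
        rw [this, zero_mul, zero_mul]
      · rw [hfix t ht.le]
        simp [H, max_eq_left ht.le])
  have hga : g a = 0 := by rw [← hfix a le_rfl, hzero]; rfl
  rw [hgY a, hga, smul_zero]

end Jost

/-! ### Construction of the Jost solution and holomorphy in `Im ρ > 0` -/

section JostSolution

open scoped BoundedContinuousFunction

set_option linter.unusedSectionVars false

variable {R : Type*} [NormedRing R] [NormedAlgebra ℂ R] [CompleteSpace R] {q : ℝ → R}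

/-- The normalized Jost solution `exp (-iρx) F(x, ρ)`. -/
def jostAmp (hq : Integrable q) (ρ : ℂ) : ℝ →ᵇ R := volterraSol hq (jostKernel ρ)

/-- The normalized derivative `exp (-iρx) F'(x, ρ)` of the Jost solution. -/
def jostAmp' (hq : Integrable q) (ρ : ℂ) : ℝ →ᵇ R :=
  (Complex.I * ρ) • (1 : ℝ →ᵇ R) - (2⁻¹ : ℂ) • volterra hq (1 + expKernel ρ) (jostAmp hq ρ)

/-- The Jost solution at `+∞`. -/
def jost (hq : Integrable q) (ρ : ℂ) (x : ℝ) : R :=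
  Complex.exp (Complex.I * ρ * x) • jostAmp hq ρ x

/-- The derivative of the Jost solution at `+∞`. -/
def jost' (hq : Integrable q) (ρ : ℂ) (x : ℝ) : R :=
  Complex.exp (Complex.I * ρ * x) • jostAmp' hq ρ x

theorem exp_neg_smul_jost (hq : Integrable q) (ρ : ℂ) (x : ℝ) :
    Complex.exp (-(Complex.I * ρ * x)) • jost hq ρ x = jostAmp hq ρ x := by
  rw [jost, smul_smul, ← Complex.exp_add, neg_add_cancel, Complex.exp_zero, one_smul]

theorem tendsto_jostAmp (hq : Integrable q) (ρ : ℂ) :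
    Tendsto (fun x => jostAmp hq ρ x) atTop (𝓝 (1 : R)) := by
  have h : ∀ x, jostAmp hq ρ x = 1 + volterra hq (jostKernel ρ) (jostAmp hq ρ) x := fun x =>
    congrArg (fun H : ℝ →ᵇ R => H x) (volterraSol_eq hq (jostKernel ρ))
  simp only [h]
  simpa using (tendsto_volterra hq (jostKernel ρ) (jostAmp hq ρ)).const_add 1

theorem tendsto_jostAmp' (hq : Integrable q) (ρ : ℂ) :
    Tendsto (fun x => jostAmp' hq ρ x) atTop (𝓝 ((Complex.I * ρ) • (1 : R))) := by
  have h : ∀ x, jostAmp' hq ρ x = (Complex.I * ρ) • (1 : R) -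
    (2⁻¹ : ℂ) • volterra hq (1 + expKernel ρ) (jostAmp hq ρ) x := fun x => rfl
  simp only [h]
  simpa using ((tendsto_volterra hq (1 + expKernel ρ) (jostAmp hq ρ)).const_smul
    (2⁻¹ : ℂ)).const_sub ((Complex.I * ρ) • (1 : R))

/-- Splitting the kernel separates the variables: `F = exp(iρx)(1 - c u) + c exp(-iρx) v`, where `c
= (2iρ)⁻¹` and `u`, `v` are tail integrals. This is variation of constants; the terms with `u'` and
`v'` cancel in `F'` and add up to `q F` in `F''`. -/
theorem isSol_jost (hq : Integrable q) {ρ : ℂ} (hρ : 0 ≤ ρ.im) (hρ0 : ρ ≠ 0) :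
    IsSol q (ρ ^ 2) (jost hq ρ) (jost' hq ρ) := by
  set G := jostAmp hq ρ with hG
  have hint : Integrable (fun t => q t * G t) := hq.mul_bdd G.continuous.aestronglyMeasurable
    (Eventually.of_forall fun t => G.norm_coe_le_norm t)
  have hre2 : (2 * Complex.I * ρ).re ≤ 0 := by
    rw [mul_assoc]
    simpa using hρ
  let p : ℝ → R := fun t => Complex.exp (2 * Complex.I * ρ * t) • (q t * G t)
  have hint2 : ∀ a, IntegrableOn p (Set.Ioi a) := fun a => by
    refine Integrable.bdd_smul (C := Real.exp ((2 * Complex.I * ρ).re * a)) hint.integrableOn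
      (Continuous.aestronglyMeasurable
        (f := fun t : ℝ => Complex.exp (2 * Complex.I * ρ * t)) (by fun_prop)) ?_
    exact (ae_restrict_iff' measurableSet_Ioi).mpr (Eventually.of_forall fun t ht =>
      norm_cexp_le hre2 (le_of_lt ht))
  have hpl : LocallyIntegrable p volume := fun x =>
    ⟨Set.Ioi (x - 1), lt_mem_nhds (sub_one_lt x), hint2 (x - 1)⟩
  let u : ℝ → R := fun x => ∫ t in Set.Ioi x, q t * G t
  let v : ℝ → R := fun x => ∫ t in Set.Ioi x, p t
  have hu : IsPrimitive u (fun x => -(q x * G x)) := by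
    refine ⟨hint.neg.locallyIntegrable, fun a b => ?_⟩
    rw [intervalIntegral.integral_neg, ← intervalIntegral.integral_Ioi_sub_Ioi'
      hint.integrableOn hint.integrableOn, neg_sub]
  have hv : IsPrimitive v (fun x => -p x) := by
    refine ⟨hpl.neg, fun a b => ?_⟩
    rw [intervalIntegral.integral_neg, ← intervalIntegral.integral_Ioi_sub_Ioi'
      (hint2 a) (hint2 b), neg_sub]
  have hvolu : ∀ x, volterra hq 1 G x = u x := fun x => by
    simp [volterra_apply, u]
  have hvolv : ∀ x : ℝ, volterra hq (expKernel ρ) G x =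
      Complex.exp (-(2 * Complex.I * ρ * x)) • v x := fun x => by
    rw [volterra_apply, ← integral_smul]
    refine setIntegral_congr_fun measurableSet_Ioi fun t ht => ?_
    rw [expKernel_apply hρ (sub_nonneg.mpr (le_of_lt ht)), smul_smul, ← Complex.exp_add]
    congr 2
    push_cast
    ring
  set c : ℂ := (2 * Complex.I * ρ)⁻¹ with hc
  have h2ρ : (2 * Complex.I * ρ) ≠ 0 := by simp [hρ0]
  have hcρ : Complex.I * ρ * c = 2⁻¹ := by
    rw [hc]
    field_simp
  have hGe : ∀ x : ℝ, G x = 1 + c • (Complex.exp (-(2 * Complex.I * ρ * x)) • v x - u x) :=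
      fun x => by
    have h1 : G x = 1 + volterra hq (jostKernel ρ) G x :=
      congrArg (fun H : ℝ →ᵇ R => H x) (volterraSol_eq hq (jostKernel ρ))
    have h2 : volterra hq (jostKernel ρ) G x = c •
        (volterra hq (expKernel ρ) G x - volterra hq 1 G x) := by
      simp [jostKernel, hc]
    rw [h1, h2, hvolv, hvolu]
  have hG'e : ∀ x : ℝ, jostAmp' hq ρ x = (Complex.I * ρ) • (1 : R) -
      (2⁻¹ : ℂ) • (u x + Complex.exp (-(2 * Complex.I * ρ * x)) • v x) := fun x => by
    have h1 : jostAmp' hq ρ x = (Complex.I * ρ) • (1 : R) -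
      (2⁻¹ : ℂ) • (volterra hq 1 G x + volterra hq (expKernel ρ) G x) := by
      simp [jostAmp', ← hG]
    rw [h1, hvolv, hvolu]
  have hexp : ∀ x : ℝ, Complex.exp (Complex.I * ρ * x) * Complex.exp (-(2 * Complex.I * ρ * x)) =
      Complex.exp (-(Complex.I * ρ) * x) := fun x => by
    rw [← Complex.exp_add]
    congr 1
    ring
  have hexp2 : ∀ x : ℝ, Complex.exp (-(Complex.I * ρ) * x) *
      Complex.exp (2 * Complex.I * ρ * x) = Complex.exp (Complex.I * ρ * x) := fun x => by
    rw [← Complex.exp_add]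
    congr 1
    ring
  have hF : jost hq ρ = fun x : ℝ => Complex.exp (Complex.I * ρ * x) • (1 - c • u x) +
      c • Complex.exp (-(Complex.I * ρ) * x) • v x := by
    funext x
    rw [jost, ← hG, hGe x, ← hexp x]
    module
  have hF' : jost' hq ρ = fun x : ℝ => (Complex.I * ρ) • (Complex.exp (Complex.I * ρ * x) •
      (1 - c • u x) - c • Complex.exp (-(Complex.I * ρ) * x) • v x) := by
    funext x
    rw [jost', hG'e x, ← hexp x, ← hcρ]
    module
  have hA := (isPrimitive_cexp_mul (Complex.I * ρ)).smul
    ((IsPrimitive.const (1 : R)).sub (hu.const_smul c))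
  have hB := ((isPrimitive_cexp_mul (-(Complex.I * ρ))).smul hv).const_smul c
  have hprim : IsPrimitive (jost hq ρ) (jost' hq ρ) := by
    rw [hF, hF']
    convert! hA.add hB using 2 with x
    simp only [p, smul_neg, smul_smul, hexp2]
    module
  have hprim' : IsPrimitive (jost' hq ρ)
      (fun x => q x * jost hq ρ x - ρ ^ 2 • jost hq ρ x) := by
    have e : (fun x => q x * jost hq ρ x - ρ ^ 2 • jost hq ρ x) =
        fun x : ℝ => Complex.exp (Complex.I * ρ * x) • (q x * G x) - ρ ^ 2 • jost hq ρ x := by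
      funext x
      congr 1
      rw [jost, mul_smul_comm]
    rw [e, hF', hF]
    convert! (hA.sub hB).const_smul (Complex.I * ρ) using 2 with x
    simp only [p, smul_neg, smul_smul, hexp2]
    have e1 : ρ ^ 2 = -(Complex.I * ρ) * (Complex.I * ρ) := by
      linear_combination (ρ ^ 2) * Complex.I_mul_I
    have e2 : (q x * G x) = (2 * (Complex.I * ρ * c)) • (q x * G x) := by
      rw [hcρ]
      norm_num
    rw [e1]
    nth_rewrite 1 [e2]
    module
  have hcont : Continuous (jost' hq ρ) := hprim'.continuous
  exact ⟨fun x => hprim.hasDerivAt hcont x, hprim'⟩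

theorem sq_mul_exp_neg_le {η s : ℝ} (hη : 0 < η) (hs : 0 ≤ s) :
    s ^ 2 * Real.exp (-(η * s)) ≤ 2 / η ^ 2 := by
  have h1 : (η * s) ^ 2 / 2 ≤ Real.exp (η * s) := by
    have := Real.quadratic_le_exp_of_nonneg (mul_nonneg hη.le hs)
    nlinarith [mul_nonneg hη.le hs]
  rw [Real.exp_neg, ← div_eq_mul_inv, div_le_div_iff₀ (Real.exp_pos _) (by positivity)]
  nlinarith

theorem mul_exp_neg_le {η s : ℝ} (hη : 0 < η) :
    s * Real.exp (-(η * s)) ≤ 1 / η := by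
  have h1 : η * s ≤ Real.exp (η * s) := by linarith [Real.add_one_le_exp (η * s)]
  rw [Real.exp_neg, ← div_eq_mul_inv, div_le_div_iff₀ (Real.exp_pos _) hη]
  linarith

/-- The difference quotient has to converge uniformly in `s ≥ 0`. The Taylor remainder is of order
`|z - ρ|² s²` times an exponential, and the decay from `Im ρ > 0` absorbs the factor `s²`. -/
theorem differentiableAt_expKernel {ρ : ℂ} (hρ : 0 < ρ.im) :
    DifferentiableAt ℂ expKernel ρ := by
  have hnorm : ∀ s : ℝ, ‖Complex.exp (2 * Complex.I * ρ * s)‖ = Real.exp (-(2 * ρ.im * s)) := by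
    intro s
    rw [Complex.norm_exp]
    congr 1
    simp
  let dK : ℝ →ᵇ ℂ := BoundedContinuousFunction.ofNormedAddCommGroup
    (fun s => (2 * Complex.I * (max s 0 : ℝ)) * Complex.exp (2 * Complex.I * ρ * (max s 0 : ℝ)))
    (by fun_prop) (1 / ρ.im) fun s => by
      have h0 : 0 ≤ max s 0 := le_max_right _ _
      rw [norm_mul, hnorm, norm_mul, norm_mul, Complex.norm_I, Complex.norm_real,
        Real.norm_of_nonneg h0]
      have := mul_exp_neg_le (η := 2 * ρ.im) (s := max s 0) (by positivity)
      have e : 1 / ρ.im = 2 * (1 / (2 * ρ.im)) := by field_simp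
      rw [e]
      simp only [Complex.norm_ofNat, mul_one]
      linarith
  refine HasDerivAt.differentiableAt (f' := dK) ?_
  rw [hasDerivAt_iff_isLittleO]
  refine Asymptotics.IsBigO.trans_isLittleO (g := fun z => ‖z - ρ‖ ^ 2) ?_
    (Asymptotics.isLittleO_pow_sub_sub ρ one_lt_two)
  refine Asymptotics.IsBigO.of_bound (8 / ρ.im ^ 2) ?_
  -- Radius `Im ρ / 2` keeps `z` in the upper half-plane, where the truncation in `expKernel` is
  -- inactive. It also leaves the decay `exp(-s Im ρ)` after the growth `exp(2 |z - ρ| s)` of the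
  -- remainder.
  filter_upwards [Metric.ball_mem_nhds ρ (half_pos hρ)] with z hz
  rw [Metric.mem_ball, dist_eq_norm] at hz
  have hzim : 0 ≤ z.im := by
    have h1 := (Complex.abs_im_le_norm (z - ρ)).trans hz.le
    rw [Complex.sub_im] at h1
    linarith [(abs_le.mp h1).1]
  rw [norm_pow, norm_norm]
  refine (BoundedContinuousFunction.norm_le (by positivity)).mpr fun r => ?_
  set s := max r 0 with hs
  have hs0 : 0 ≤ s := le_max_right _ _
  have hK : ∀ w : ℂ, 0 ≤ w.im → expKernel w r = Complex.exp (2 * Complex.I * w * s) :=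
    fun w hw => by
      simp only [expKernel, BoundedContinuousFunction.coe_ofNormedAddCommGroup, max_eq_left hw,
        hs]
  have hval : (expKernel z - expKernel ρ - (z - ρ) • dK) r =
      Complex.exp (2 * Complex.I * ρ * s) * (Complex.exp (2 * Complex.I * (z - ρ) * s) -
        ∑ k ∈ Finset.range 2, (2 * Complex.I * (z - ρ) * s) ^ k / (k.factorial : ℂ)) := by
    have h1 : Complex.exp (2 * Complex.I * z * s) = Complex.exp (2 * Complex.I * ρ * s) *
        Complex.exp (2 * Complex.I * (z - ρ) * s) := by
      rw [← Complex.exp_add]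
      congr 1
      ring
    have h2 : dK r = (2 * Complex.I * (s : ℝ)) * Complex.exp (2 * Complex.I * ρ * (s : ℝ)) := rfl
    simp only [BoundedContinuousFunction.coe_sub, BoundedContinuousFunction.coe_smul,
      Pi.sub_apply, hK z hzim, hK ρ hρ.le, h2, h1, Finset.sum_range_succ, Finset.sum_range_zero,
      smul_eq_mul]
    simp
    ring
  have hw : ‖2 * Complex.I * (z - ρ) * s‖ = 2 * ‖z - ρ‖ * s := by
    simp [abs_of_nonneg hs0]
  rw [hval, norm_mul, hnorm]
  have h3 := Complex.norm_exp_sub_sum_le_norm_mul_exp (2 * Complex.I * (z - ρ) * s) 2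
  rw [hw] at h3
  calc Real.exp (-(2 * ρ.im * s)) * _
      ≤ Real.exp (-(2 * ρ.im * s)) * ((2 * ‖z - ρ‖ * s) ^ 2 * Real.exp (2 * ‖z - ρ‖ * s)) :=
        mul_le_mul_of_nonneg_left h3 (Real.exp_pos _).le
    _ ≤ Real.exp (-(2 * ρ.im * s)) * ((2 * ‖z - ρ‖ * s) ^ 2 * Real.exp (ρ.im * s)) := by
        gcongr
        linarith
    _ = 4 * ‖z - ρ‖ ^ 2 * (s ^ 2 * Real.exp (-(ρ.im * s))) := by
        have : Real.exp (-(2 * ρ.im * s)) * Real.exp (ρ.im * s) = Real.exp (-(ρ.im * s)) := by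
          rw [← Real.exp_add]
          congr 1
          ring
        rw [← this]
        ring
    _ ≤ 4 * ‖z - ρ‖ ^ 2 * (2 / ρ.im ^ 2) := by
        gcongr
        exact sq_mul_exp_neg_le hρ hs0
    _ = 8 / ρ.im ^ 2 * ‖z - ρ‖ ^ 2 := by ring

theorem differentiableAt_jostAmp (hq : Integrable q) {ρ : ℂ} (hρ : 0 < ρ.im) :
    DifferentiableAt ℂ (fun z => jostAmp hq z) ρ := by
  refine differentiableAt_volterraSol hq (κ := jostKernel) ?_
  have h2ρ : (2 * Complex.I * ρ) ≠ 0 := by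
    have : ρ ≠ 0 := fun h => by simp [h] at hρ
    simp [this]
  have h1 : DifferentiableAt ℂ (fun z : ℂ => (2 * Complex.I * z)⁻¹) ρ :=
    (differentiableAt_id.const_mul _).inv h2ρ
  exact h1.smul ((differentiableAt_expKernel hρ).sub_const 1)

theorem differentiableAt_jostAmp' (hq : Integrable q) {ρ : ℂ} (hρ : 0 < ρ.im) :
    DifferentiableAt ℂ (fun z => jostAmp' hq z) ρ := by
  have h1 : DifferentiableAt ℂ (fun z => volterra hq (1 + expKernel z)) ρ :=
    DifferentiableAt.comp ρ (g := fun κ => volterra hq κ) (volterra hq).differentiableAt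
      ((differentiableAt_expKernel hρ).const_add 1)
  have h2 := h1.clm_apply (differentiableAt_jostAmp hq hρ)
  have h3 : DifferentiableAt ℂ (fun z : ℂ => (Complex.I * z) • (1 : ℝ →ᵇ R)) ρ :=
    (differentiableAt_id.const_mul _).smul_const _
  exact h3.sub (h2.const_smul (2⁻¹ : ℂ))

theorem differentiableAt_bcf_apply {H : ℂ → ℝ →ᵇ R} {ρ : ℂ} (h : DifferentiableAt ℂ H ρ) (x : ℝ) :
    DifferentiableAt ℂ (fun z => H z x) ρ :=
  ((BoundedContinuousFunction.evalCLM ℂ x : (ℝ →ᵇ R) →L[ℂ] R).differentiableAt (x := H ρ)).comp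
    ρ h

theorem differentiableAt_jost (hq : Integrable q) {ρ : ℂ} (hρ : 0 < ρ.im) (x : ℝ) :
    DifferentiableAt ℂ (fun z => jost hq z x) ρ := by
  have h1 : DifferentiableAt ℂ (fun z => jostAmp hq z x) ρ :=
    differentiableAt_bcf_apply (differentiableAt_jostAmp hq hρ) x
  have h2 : DifferentiableAt ℂ (fun z : ℂ => Complex.exp (Complex.I * z * x)) ρ := by fun_prop
  exact h2.smul h1

theorem differentiableAt_jost' (hq : Integrable q) {ρ : ℂ} (hρ : 0 < ρ.im) (x : ℝ) :
    DifferentiableAt ℂ (fun z => jost' hq z x) ρ := by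
  have h1 : DifferentiableAt ℂ (fun z => jostAmp' hq z x) ρ :=
    differentiableAt_bcf_apply (differentiableAt_jostAmp' hq hρ) x
  have h2 : DifferentiableAt ℂ (fun z : ℂ => Complex.exp (Complex.I * z * x)) ρ := by fun_prop
  exact h2.smul h1

end JostSolution

/-! ### Wronskian identities and the Gram integral -/

section Wronskian

open scoped BoundedContinuousFunction ComplexConjugate

set_option linter.unusedSectionVars false

variable {R : Type*} [CStarAlgebra R] {q : ℝ → R}

theorem IsPrimitive.star {F f : ℝ → R} (h : IsPrimitive F f) :
    IsPrimitive (fun x => star (F x)) (fun x => star (f x)) := by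
  refine ⟨fun x => ?_, fun a b => ?_⟩
  · obtain ⟨s, hs, hi⟩ := h.locallyIntegrable x
    exact ⟨s, hs, ((starL' ℝ : R ≃L[ℝ] R) : R →L[ℝ] R).integrable_comp hi⟩
  · rw [← star_sub, h.sub_eq]
    exact (((starL' ℝ : R ≃L[ℝ] R) : R →L[ℝ] R).intervalIntegral_comp_comm
      (h.intervalIntegrable a b)).symm

/-- The Wronskian `⟨Z*, Y⟩` with the derivatives supplied explicitly. -/
def starWronskian (Z Z' Y Y' : ℝ → R) (x : ℝ) : R := star (Z' x) * Y x - star (Z x) * Y' x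

/-- On differentiating, the first-order products cancel, and so do the terms with `q`, since `q` is
self-adjoint. Only the difference of spectral parameters survives. -/
theorem isPrimitive_starWronskian (hs : ∀ᵐ x, star (q x) = q x) {lam mu : ℂ} {Y Y' Z Z' : ℝ → R}
    (hY : IsSol q lam Y Y') (hZ : IsSol q mu Z Z') :
    IsPrimitive (starWronskian Z Z' Y Y') (fun x => (lam - conj mu) • (star (Z x) * Y x)) := by
  refine ((hZ.isPrimitive.star.mul hY.isPrimitive_self).sub
    (hZ.isPrimitive_self.star.mul hY.isPrimitive)).congr_ae ?_
  filter_upwards [hs] with x hx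
  have e : star (mu • Z x) = conj mu • star (Z x) := star_smul mu (Z x)
  rw [star_sub, star_mul, hx, e, sub_mul, mul_sub, smul_mul_assoc, mul_smul_comm, sub_smul,
    mul_assoc]
  abel

theorem starWronskian_eq (hs : ∀ᵐ x, star (q x) = q x) {lam mu : ℂ} (h : lam = conj mu)
    {Y Y' Z Z' : ℝ → R} (hY : IsSol q lam Y Y') (hZ : IsSol q mu Z Z') (x y : ℝ) :
    starWronskian Z Z' Y Y' x = starWronskian Z Z' Y Y' y := by
  have := (isPrimitive_starWronskian hs hY hZ).sub_eq y x
  rw [h, sub_self] at this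
  simpa [sub_eq_zero] using this

theorem starWronskian_jost (hq : Integrable q) (σ ρ : ℂ) (x : ℝ) :
    starWronskian (jost hq σ) (jost' hq σ) (jost hq ρ) (jost' hq ρ) x =
      Complex.exp ((Complex.I * (ρ - conj σ)) * x) •
        (star (jostAmp' hq σ x) * jostAmp hq ρ x - star (jostAmp hq σ x) * jostAmp' hq ρ x) := by
  have e : Complex.exp ((Complex.I * (ρ - conj σ)) * x) =
      conj (Complex.exp (Complex.I * σ * x)) * Complex.exp (Complex.I * ρ * x) := by
    rw [← Complex.exp_conj, ← Complex.exp_add]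
    congr 1
    simp
    ring
  have e2 : ∀ (c : ℂ) (a : R), star (c • a) = conj c • star a := star_smul
  simp only [starWronskian, jost, jost', e2, smul_mul_assoc, mul_smul_comm, smul_smul]
  rw [e, mul_comm (Complex.exp (Complex.I * ρ * x)), smul_sub]

theorem tendsto_jostAmp_wronskian (hq : Integrable q) (σ ρ : ℂ) :
    Tendsto (fun x => star (jostAmp' hq σ x) * jostAmp hq ρ x -
      star (jostAmp hq σ x) * jostAmp' hq ρ x) atTop
      (𝓝 ((-(Complex.I * (ρ + conj σ))) • (1 : R))) := by
  have h := ((tendsto_jostAmp' hq σ).star.mul (tendsto_jostAmp hq ρ)).sub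
    ((tendsto_jostAmp hq σ).star.mul (tendsto_jostAmp' hq ρ))
  convert! h using 2
  have e2 : star ((Complex.I * σ) • (1 : R)) = conj (Complex.I * σ) • (1 : R) := by
    rw [star_smul, star_one]
    rfl
  rw [e2, star_one, mul_one, one_mul, map_mul, Complex.conj_I]
  module

theorem sq_neg_conj (ρ : ℂ) : conj ((-conj ρ) ^ 2) = ρ ^ 2 := by simp

/-- The Wronskian is constant, and at `+∞` it is a bounded exponential times an amplitude Wronskian
that tends to `0`. -/
theorem starWronskian_jost_neg_conj (hq : Integrable q) (hs : ∀ᵐ x, star (q x) = q x) {ρ : ℂ}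
    (hρ : 0 ≤ ρ.im) (hρ0 : ρ ≠ 0) (x : ℝ) :
    starWronskian (jost hq (-conj ρ)) (jost' hq (-conj ρ)) (jost hq ρ) (jost' hq ρ) x = (0 : R) := by
  have hS := isSol_jost hq hρ hρ0
  have hS2 := isSol_jost hq (ρ := -conj ρ) (by simpa using hρ) (by simpa using hρ0)
  have hc := starWronskian_eq hs (sq_neg_conj ρ).symm hS hS2
  have h0 : Tendsto (fun y => starWronskian (jost hq (-conj ρ)) (jost' hq (-conj ρ)) (jost hq ρ)
      (jost' hq ρ) y) atTop (𝓝 0) := by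
    have hlim := (tendsto_jostAmp_wronskian hq (-conj ρ) ρ).norm
    simp only [map_neg, Complex.conj_conj, add_neg_cancel, mul_zero, neg_zero, zero_smul,
      norm_zero] at hlim
    refine squeeze_zero_norm' ?_ hlim
    filter_upwards [eventually_ge_atTop 0] with y hy
    rw [starWronskian_jost, norm_smul]
    have hre : (Complex.I * (ρ - conj (-conj ρ))).re ≤ 0 := by
      simp
      linarith
    have := norm_cexp_le hre hy
    rw [mul_zero, Real.exp_zero] at this
    exact mul_le_of_le_one_left (norm_nonneg _) this
  refine tendsto_nhds_unique (tendsto_const_nhds.congr fun y => ?_) h0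
  exact hc x y

/-- For real `ρ` the exponential factors cancel, so the constant is read off from the limit of the
amplitudes. -/
theorem starWronskian_jost_self (hq : Integrable q) (hs : ∀ᵐ x, star (q x) = q x) {ρ : ℝ}
    (hρ0 : ρ ≠ 0) (x : ℝ) :
    starWronskian (jost hq ρ) (jost' hq ρ) (jost hq ρ) (jost' hq ρ) x =
      (-(2 * Complex.I * ρ)) • (1 : R) := by
  have hS := isSol_jost hq (ρ := (ρ : ℂ)) (by simp) (by simpa using hρ0)
  have hc := starWronskian_eq hs (by simp) hS hS
  have hlim := tendsto_jostAmp_wronskian hq (ρ : ℂ) (ρ : ℂ)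
  have h1 : Tendsto (fun y : ℝ => starWronskian (jost hq ρ) (jost' hq ρ) (jost hq ρ)
      (jost' hq ρ) y) atTop (𝓝 ((-(Complex.I * (ρ + conj (ρ : ℂ)))) • (1 : R))) := by
    refine hlim.congr fun y => ?_
    rw [starWronskian_jost]
    simp
  have h2 := tendsto_nhds_unique (tendsto_const_nhds.congr fun y => hc x y) h1
  rw [h2, Complex.conj_ofReal]
  congr 1
  ring

theorem eventually_isUnit_jost (hq : Integrable q) (ρ : ℂ) :
    ∀ᶠ x in atTop, IsUnit (jost hq ρ x) := by
  have h1 : ∀ᶠ y in 𝓝 (1 : R), IsUnit y := Units.isOpen.mem_nhds isUnit_one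
  filter_upwards [(tendsto_jostAmp hq ρ).eventually h1] with x hx
  rw [jost, Algebra.smul_def]
  exact (((Complex.exp_ne_zero _).isUnit).map (algebraMap ℂ R)).mul hx

/-- Solutions with vanishing Wronskian against the dual Jost solution are multiples of the Jost
solution. -/
theorem exists_eq_jost_mul (hq : Integrable q) (hs : ∀ᵐ x, star (q x) = q x) {ρ : ℂ}
    (hρ : 0 ≤ ρ.im) (hρ0 : ρ ≠ 0) {Y Y' : ℝ → R} (hY : IsSol q (ρ ^ 2) Y Y')
    (hw : ∀ x, starWronskian (jost hq (-conj ρ)) (jost' hq (-conj ρ)) Y Y' x = 0) :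
    ∃ w, ∀ x, Y x = jost hq ρ x * w := by
  obtain ⟨N, hN⟩ := eventually_atTop.mp
    ((eventually_isUnit_jost hq ρ).and (eventually_isUnit_jost hq (-conj ρ)))
  have hF := isSol_jost hq hρ hρ0
  have hFw := starWronskian_jost_neg_conj hq hs hρ hρ0
  set F := jost hq ρ
  set F' := jost' hq ρ
  set Z := jost hq (-conj ρ)
  set Z' := jost' hq (-conj ρ)
  -- Beyond `N`, where `Z` is invertible, the vanishing Wronskians say that `F` and `Y` both solve
  -- the first-order equation `y' = (Z*)⁻¹ (Z')* y`. Therefore `F⁻¹ Y` is constant there.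
  have hd : ∀ x, N ≤ x → HasDerivAt (fun t => Ring.inverse (F t) * Y t) 0 x := by
    intro x hx
    obtain ⟨⟨u, hu⟩, hZu⟩ := hN x hx
    obtain ⟨z, hz⟩ := hZu.star
    have h1 : HasDerivAt (fun t => Ring.inverse (F t)) (-(↑u⁻¹ * F' x * ↑u⁻¹)) x := by
      have h2 := hasFDerivAt_ringInverse (𝕜 := ℝ) u
      rw [hu] at h2
      exact h2.comp_hasDerivAt x (hF.hasDerivAt x)
    have h3 := h1.mul (hY.hasDerivAt x)
    convert! h3 using 1
    have hF1 : F' x * ↑u⁻¹ = ↑z⁻¹ * star (Z' x) := by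
      have := hFw x
      rw [starWronskian, sub_eq_zero, ← hu, ← hz] at this
      rw [Units.eq_inv_mul_iff_mul_eq, ← mul_assoc, ← this, Units.mul_inv_cancel_right]
    have hY1 : Y' x = ↑z⁻¹ * star (Z' x) * Y x := by
      have := hw x
      rw [starWronskian, sub_eq_zero, ← hz] at this
      rw [mul_assoc, this, Units.inv_mul_cancel_left]
    rw [← hu, Ring.inverse_unit, hY1, mul_assoc, hF1]
    noncomm_ring
  have hconst : ∀ x, N ≤ x → Ring.inverse (F x) * Y x = Ring.inverse (F N) * Y N := by
    intro x hx
    have := Convex.norm_image_sub_le_of_norm_hasDerivWithin_le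
      (f := fun t => Ring.inverse (F t) * Y t) (f' := fun _ => (0 : R)) (C := 0)
      (s := Set.Ici N) (x := N) (y := x) (fun t ht => (hd t ht).hasDerivWithinAt)
      (fun _ _ => by simp) (convex_Ici N) (by simp) hx
    rw [zero_mul] at this
    exact sub_eq_zero.mp (norm_le_zero_iff.mp this)
  refine ⟨Ring.inverse (F N) * Y N, fun x => ?_⟩
  have hD := hY.sub (hF.mul_const (Ring.inverse (F N) * Y N))
  -- The identity known for `x ≥ N` extends to the whole line because a solution vanishing near `+∞`
  -- is zero.
  refine sub_eq_zero.mp (hD.eq_zero_of_tendsto hq hρ hρ0 ?_ x)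
  refine tendsto_const_nhds.congr' ?_
  filter_upwards [eventually_ge_atTop N] with y hy
  rw [← hconst y hy, ← mul_assoc, Ring.mul_inverse_cancel _ (hN y hy).1, one_mul, sub_self,
    smul_zero]

/-- The Gram integral `∫_0^∞ F* F` of the Jost solution. -/
def jostGram (hq : Integrable q) (ρ : ℂ) : R :=
  ∫ x in Set.Ioi (0 : ℝ), star (jost hq ρ x) * jost hq ρ x

theorem continuous_jost (hq : Integrable q) (ρ : ℂ) : Continuous (jost hq ρ) := by
  unfold jost
  exact Continuous.smul (by fun_prop) (jostAmp hq ρ).continuous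

theorem norm_star_jost_mul_jost_le (hq : Integrable q) {ρ z : ℂ} (hz : 0 ≤ z.im) {x : ℝ}
    (hx : 0 ≤ x) : ‖star (jost hq ρ x) * jost hq z x‖ ≤
      ‖jostAmp hq ρ‖ * ‖jostAmp hq z‖ * Real.exp (-ρ.im * x) := by
  have h1 : ‖Complex.exp (Complex.I * z * x)‖ ≤ 1 := by
    have := norm_cexp_le (c := Complex.I * z) (by simpa using hz) hx
    rwa [mul_zero, Real.exp_zero] at this
  have h2 : ‖Complex.exp (Complex.I * ρ * x)‖ = Real.exp (-ρ.im * x) := by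
    rw [Complex.norm_exp]
    simp
  refine (norm_mul_le _ _).trans ?_
  rw [norm_star, jost, jost, norm_smul, norm_smul, h2]
  calc Real.exp (-ρ.im * x) * ‖jostAmp hq ρ x‖ *
        (‖Complex.exp (Complex.I * z * x)‖ * ‖jostAmp hq z x‖)
      ≤ Real.exp (-ρ.im * x) * ‖jostAmp hq ρ‖ * (1 * ‖jostAmp hq z‖) := by
        gcongr
        · exact (jostAmp hq ρ).norm_coe_le_norm x
        · exact (jostAmp hq z).norm_coe_le_norm x
    _ = _ := by ring

theorem integrableOn_exp_neg {τ : ℝ} (hτ : 0 < τ) :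
    IntegrableOn (fun x : ℝ => Real.exp (-τ * x)) (Set.Ioi 0) :=
  by simpa using exp_neg_integrableOn_Ioi 0 hτ

theorem integrableOn_star_jost_mul_jost (hq : Integrable q) {ρ z : ℂ} (hρ : 0 < ρ.im)
    (hz : 0 ≤ z.im) :
    IntegrableOn (fun x => star (jost hq ρ x) * jost hq z x) (Set.Ioi 0) := by
  refine Integrable.mono' ((integrableOn_exp_neg hρ).const_mul (‖jostAmp hq ρ‖ * ‖jostAmp hq z‖))
    (((continuous_jost hq ρ).star.mul (continuous_jost hq z)).aestronglyMeasurable) ?_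
  exact (ae_restrict_iff' measurableSet_Ioi).mpr (Eventually.of_forall fun x hx =>
    norm_star_jost_mul_jost_le hq hz (le_of_lt hx))

/-- Integration of the Wronskian derivative over `(0, ∞)`; the contribution at `+∞` vanishes because
both Jost solutions decay. -/
theorem starWronskian_jost_zero (hq : Integrable q) (hs : ∀ᵐ x, star (q x) = q x) {ρ z : ℂ}
    (hρ : 0 < ρ.im) (hz : 0 < z.im) :
    starWronskian (jost hq ρ) (jost' hq ρ) (jost hq z) (jost' hq z) 0 =
      (-((z ^ 2 - conj (ρ ^ 2)) • ∫ x in Set.Ioi (0 : ℝ), star (jost hq ρ x) * jost hq z x) :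
        R) := by
  have hne : ∀ w : ℂ, 0 < w.im → w ≠ 0 := fun w hw h => by simp [h] at hw
  have hp := isPrimitive_starWronskian hs (isSol_jost hq hz.le (hne z hz))
    (isSol_jost hq hρ.le (hne ρ hρ))
  have hl := hp.tendsto_atTop
    ((integrableOn_star_jost_mul_jost hq hρ hz.le).smul (z ^ 2 - conj (ρ ^ 2)))
  have h0 : Tendsto (starWronskian (jost hq ρ) (jost' hq ρ) (jost hq z) (jost' hq z)) atTop
      (𝓝 0) := by
    have e1 : Tendsto (fun x : ℝ => Complex.exp ((Complex.I * (z - conj ρ)) * x)) atTop (𝓝 0) := by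
      rw [tendsto_zero_iff_norm_tendsto_zero]
      have : ∀ x : ℝ, ‖Complex.exp ((Complex.I * (z - conj ρ)) * x)‖ =
          Real.exp (-((z.im + ρ.im) * x)) := fun x => by
        rw [Complex.norm_exp]
        congr 1
        simp
        ring
      simp only [this]
      exact Real.tendsto_exp_neg_atTop_nhds_zero.comp
        (tendsto_id.const_mul_atTop (add_pos hz hρ))
    have := e1.smul (tendsto_jostAmp_wronskian hq ρ z)
    rw [zero_smul] at this
    exact this.congr fun x => (starWronskian_jost hq ρ z x).symm
  have := tendsto_nhds_unique hl h0
  rw [integral_smul] at this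
  exact eq_neg_of_add_eq_zero_left this

theorem tendsto_integral_star_jost (hq : Integrable q) {ρ : ℂ} (hρ : 0 < ρ.im) :
    Tendsto (fun z => ∫ x in Set.Ioi (0 : ℝ), star (jost hq ρ x) * jost hq z x) (𝓝 ρ)
      (𝓝 (jostGram hq ρ)) := by
  have hb : ∀ᶠ z in 𝓝 ρ, ‖jostAmp hq z‖ < ‖jostAmp hq ρ‖ + 1 :=
    (differentiableAt_jostAmp hq hρ).continuousAt.norm.eventually_lt_const (by linarith)
  have him : ∀ᶠ z : ℂ in 𝓝 ρ, 0 < z.im := Complex.continuous_im.continuousAt.eventually_const_lt hρ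
  refine tendsto_integral_filter_of_dominated_convergence
    (fun x => ‖jostAmp hq ρ‖ * (‖jostAmp hq ρ‖ + 1) * Real.exp (-ρ.im * x)) ?_ ?_
    ((integrableOn_exp_neg hρ).const_mul _) ?_
  · exact Eventually.of_forall fun z =>
      ((continuous_jost hq ρ).star.mul (continuous_jost hq z)).aestronglyMeasurable
  · filter_upwards [hb, him] with z hz1 hz2
    refine (ae_restrict_iff' measurableSet_Ioi).mpr (Eventually.of_forall fun x hx => ?_)
    refine (norm_star_jost_mul_jost_le hq hz2.le (le_of_lt hx)).trans ?_
    gcongr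
  · exact Eventually.of_forall fun x =>
      ((differentiableAt_jost hq hρ x).continuousAt.tendsto).const_mul _

/-- For real `ρ ^ 2` the factor `z ^ 2 - ρ ^ 2` in `starWronskian_jost_zero` splits off `z - ρ`, and
the remaining integral is continuous in `z` by domination. Derivatives in the spectral parameter
thus become `L²` norms. -/
theorem hasDerivAt_starWronskian_jost (hq : Integrable q) (hs : ∀ᵐ x, star (q x) = q x) {ρ : ℂ}
    (hρ : 0 < ρ.im) (hre : conj (ρ ^ 2) = ρ ^ 2) :
    HasDerivAt (fun z => starWronskian (jost hq ρ) (jost' hq ρ) (jost hq z) (jost' hq z) 0)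
      (-((2 * ρ) • jostGram hq ρ) : R) ρ := by
  have him : ∀ᶠ z : ℂ in 𝓝[≠] ρ, 0 < z.im :=
    nhdsWithin_le_nhds (Complex.continuous_im.continuousAt.eventually_const_lt hρ)
  rw [hasDerivAt_iff_tendsto_slope]
  have h1 : Tendsto (fun z => -((z + ρ) • ∫ x in Set.Ioi (0 : ℝ),
      star (jost hq ρ x) * jost hq z x)) (𝓝[≠] ρ) (𝓝 (-((2 * ρ) • jostGram hq ρ))) := by
    have h2 : Tendsto (fun z : ℂ => z + ρ) (𝓝 ρ) (𝓝 (2 * ρ)) := by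
      rw [two_mul]
      exact tendsto_id.add_const ρ
    exact ((h2.smul (tendsto_integral_star_jost hq hρ)).neg).mono_left nhdsWithin_le_nhds
  refine h1.congr' ?_
  filter_upwards [him, self_mem_nhdsWithin] with z hz hne
  have hne' : z - ρ ≠ 0 := sub_ne_zero.mpr hne
  rw [slope_def_module, starWronskian_jost_zero hq hs hρ hz, starWronskian_jost_zero hq hs hρ hρ,
    hre, sub_self, zero_smul, neg_zero, sub_zero, smul_neg, smul_smul]
  congr 2
  field_simp
  ring

end Wronskian

/-! ### From entrywise definitions to the C*-algebra of matrices -/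

section MatrixJost

open scoped Matrix.Norms.L2Operator ComplexConjugate

variable {m : ℕ} {Q : ℝ → Matrix (Fin m) (Fin m) ℂ}

/-- A matrix entry as a continuous real-linear map. -/
def entryCLM (i j : Fin m) : Matrix (Fin m) (Fin m) ℂ →L[ℝ] ℂ :=
  (LinearMap.toContinuousLinearMap (Matrix.entryLinearMap ℂ ℂ i j)).restrictScalars ℝ

theorem integrable_of_weighted
    (hint : ∀ j k, Integrable (fun x : ℝ => (1 + |x|) • Q x j k) volume) : Integrable Q := by
  have h1 : ∀ j k, Integrable (fun x => Q x j k) := fun j k => by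
    have := (hint j k).bdd_smul (φ := fun x : ℝ => (1 + |x|)⁻¹) (C := 1)
      (Continuous.aestronglyMeasurable (by
        refine Continuous.inv₀ (by fun_prop) fun x => ?_
        positivity)) (Eventually.of_forall fun x => by
        rw [norm_inv, Real.norm_of_nonneg (by positivity)]
        exact inv_le_one_of_one_le₀ (by linarith [abs_nonneg x]))
    refine this.congr (Eventually.of_forall fun x => ?_)
    have hx : (1 + |x|) ≠ 0 := by positivity
    simp only [Pi.smul_apply', smul_smul, inv_mul_cancel₀ hx, one_smul]
  have e : Q = fun x => ∑ j, ∑ k, Q x j k • (Matrix.single j k 1 : Matrix (Fin m) (Fin m) ℂ) := by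
    funext x
    conv_lhs => rw [Matrix.matrix_eq_sum_single (Q x)]
    simp [Matrix.smul_single]
  rw [e]
  exact integrable_finsetSum _ fun j _ => integrable_finsetSum _ fun k _ => (h1 j k).smul_const _

theorem hasDerivAt_matrix {Y : ℝ → Matrix (Fin m) (Fin m) ℂ} {Y' : Matrix (Fin m) (Fin m) ℂ}
    {x : ℝ} (h : ∀ i j, HasDerivAt (fun t => Y t i j) (Y' i j) x) : HasDerivAt Y Y' x := by
  have e : ∀ A : Matrix (Fin m) (Fin m) ℂ,
      A = ∑ j, ∑ k, A j k • (Matrix.single j k 1 : Matrix (Fin m) (Fin m) ℂ) := fun A => by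
    conv_lhs => rw [Matrix.matrix_eq_sum_single A]
    simp [Matrix.smul_single]
  have h1 : HasDerivAt (fun t => ∑ j, ∑ k, Y t j k •
      (Matrix.single j k 1 : Matrix (Fin m) (Fin m) ℂ)) (∑ j, ∑ k, Y' j k •
      (Matrix.single j k 1 : Matrix (Fin m) (Fin m) ℂ)) x :=
    HasDerivAt.fun_sum fun j _ => HasDerivAt.fun_sum fun k _ => (h j k).smul_const _
  rw [← e Y'] at h1
  exact h1.congr_of_eventuallyEq (Eventually.of_forall fun t => e (Y t))

theorem HasDerivAt.matrix_entry {Y : ℝ → Matrix (Fin m) (Fin m) ℂ} {Y' : Matrix (Fin m) (Fin m) ℂ}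
    {x : ℝ} (h : HasDerivAt Y Y' x) (i j : Fin m) : HasDerivAt (fun t => Y t i j) (Y' i j) x :=
  (entryCLM i j).hasFDerivAt.comp_hasDerivAt x h

theorem matDeriv_eq {Y : ℝ → Matrix (Fin m) (Fin m) ℂ} {Y' : Matrix (Fin m) (Fin m) ℂ}
    {x : ℝ} (h : HasDerivAt Y Y' x) : matDeriv Y x = Y' := by
  ext i j
  exact (HasDerivAt.matrix_entry h i j).deriv

theorem intervalIntegral_entry {f : ℝ → Matrix (Fin m) (Fin m) ℂ} {a b : ℝ}
    (hf : IntervalIntegrable f volume a b) (i j : Fin m) :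
    (∫ t in a..b, f t) i j = ∫ t in a..b, f t i j :=
  ((entryCLM i j).intervalIntegral_comp_comm hf).symm

theorem IsSolution.isSol (hq : Integrable Q) {lam : ℂ} {Y : ℝ → Matrix (Fin m) (Fin m) ℂ}
    (h : IsSolution Q lam Y) : IsSol Q lam Y (matDeriv Y) := by
  have hd : ∀ x, HasDerivAt Y (matDeriv Y x) x := fun x =>
    hasDerivAt_matrix fun i j => (h.1 i j x).hasDerivAt
  have hc : Continuous Y := continuous_iff_continuousAt.mpr fun x => (hd x).continuousAt
  have hl : LocallyIntegrable (fun x => Q x * Y x - lam • Y x) volume :=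
    (locallyIntegrable_mul_continuous hc hq.locallyIntegrable).sub
      (hc.const_smul lam).locallyIntegrable
  refine ⟨hd, hl, fun a b => ?_⟩
  ext i j
  rw [intervalIntegral_entry (intervalIntegrable_of_locallyIntegrable hl a b), Matrix.sub_apply,
    h.2 a b i j]
  rfl

theorem IsSol.isSolution {lam : ℂ} {Y Y' : ℝ → Matrix (Fin m) (Fin m) ℂ}
    (h : IsSol Q lam Y Y') : IsSolution Q lam Y := by
  have e : matDeriv Y = Y' := funext fun x => matDeriv_eq (h.hasDerivAt x)
  refine ⟨fun i j x => (HasDerivAt.matrix_entry (h.hasDerivAt x) i j).differentiableAt,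
    fun a b i j => ?_⟩
  rw [e, ← Matrix.sub_apply, h.isPrimitive.sub_eq a b,
    intervalIntegral_entry (h.isPrimitive.intervalIntegrable a b)]
  rfl

theorem isJostPlus_jost (hq : Integrable Q) {ρ : ℂ} (hρ : 0 ≤ ρ.im) (hρ0 : ρ ≠ 0) :
    IsJostPlus Q ρ (jost hq ρ) := by
  refine ⟨(isSol_jost hq hρ hρ0).isSolution, ?_⟩
  simp only [exp_neg_smul_jost]
  exact tendsto_jostAmp hq ρ

theorem IsJostPlus.eq_jost (hq : Integrable Q) {ρ : ℂ} (hρ : 0 ≤ ρ.im) (hρ0 : ρ ≠ 0)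
    {F : ℝ → Matrix (Fin m) (Fin m) ℂ} (h : IsJostPlus Q ρ F) : F = jost hq ρ := by
  funext x
  refine sub_eq_zero.mp (((h.1.isSol hq).sub (isSol_jost hq hρ hρ0)).eq_zero_of_tendsto hq hρ hρ0
    ?_ x)
  have h2 := h.2.sub (isJostPlus_jost hq hρ hρ0).2
  rw [sub_self] at h2
  simpa only [smul_sub] using h2

theorem existsUnique_isJostPlus (hq : Integrable Q) {ρ : ℂ} (hρ : 0 ≤ ρ.im) (hρ0 : ρ ≠ 0) :
    ∃! F, IsJostPlus Q ρ F :=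
  ⟨jost hq ρ, isJostPlus_jost hq hρ hρ0, fun _ h => h.eq_jost hq hρ hρ0⟩

theorem jostPlus_eq (hq : Integrable Q) {ρ : ℂ} (hρ : 0 ≤ ρ.im) (hρ0 : ρ ≠ 0) :
    jostPlus Q ρ = jost hq ρ :=
  IsJostPlus.eq_jost hq hρ hρ0 (Classical.epsilon_spec ⟨_, isJostPlus_jost hq hρ hρ0⟩)

theorem IsSolution.comp_neg (hq : Integrable Q) {lam : ℂ} {Y : ℝ → Matrix (Fin m) (Fin m) ℂ}
    (h : IsSolution Q lam Y) : IsSolution (fun x => Q (-x)) lam fun x => Y (-x) :=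
  (h.isSol hq).comp_neg.isSolution

/-- The reflection principle by which all statements at `-∞` are deduced from those at `+∞`. -/
theorem isJostMinus_iff (hq : Integrable Q) {ρ : ℂ} {F : ℝ → Matrix (Fin m) (Fin m) ℂ} :
    IsJostMinus Q ρ F ↔ IsJostPlus (fun x => Q (-x)) ρ (fun x => F (-x)) := by
  constructor
  · rintro ⟨h1, h2⟩
    refine ⟨h1.comp_neg hq, ?_⟩
    refine (h2.comp tendsto_neg_atTop_atBot).congr fun x => ?_
    simp
  · rintro ⟨h1, h2⟩
    refine ⟨by simpa using h1.comp_neg hq.comp_neg, ?_⟩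
    refine (h2.comp tendsto_neg_atBot_atTop).congr fun x => ?_
    simp

theorem isJostMinus_jost (hq : Integrable Q) {ρ : ℂ} (hρ : 0 ≤ ρ.im) (hρ0 : ρ ≠ 0) :
    IsJostMinus Q ρ fun x => jost hq.comp_neg ρ (-x) := by
  rw [isJostMinus_iff hq]
  simpa using isJostPlus_jost hq.comp_neg hρ hρ0

theorem IsJostMinus.eq_jost (hq : Integrable Q) {ρ : ℂ} (hρ : 0 ≤ ρ.im) (hρ0 : ρ ≠ 0)
    {F : ℝ → Matrix (Fin m) (Fin m) ℂ} (h : IsJostMinus Q ρ F) :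
    F = fun x => jost hq.comp_neg ρ (-x) := by
  have := ((isJostMinus_iff hq).mp h).eq_jost hq.comp_neg hρ hρ0
  funext x
  simpa using congrFun this (-x)

theorem existsUnique_isJostMinus (hq : Integrable Q) {ρ : ℂ} (hρ : 0 ≤ ρ.im) (hρ0 : ρ ≠ 0) :
    ∃! F, IsJostMinus Q ρ F :=
  ⟨_, isJostMinus_jost hq hρ hρ0, fun _ h => h.eq_jost hq hρ hρ0⟩

theorem jostMinus_eq (hq : Integrable Q) {ρ : ℂ} (hρ : 0 ≤ ρ.im) (hρ0 : ρ ≠ 0) :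
    jostMinus Q ρ = fun x => jost hq.comp_neg ρ (-x) :=
  IsJostMinus.eq_jost hq hρ hρ0 (Classical.epsilon_spec ⟨_, isJostMinus_jost hq hρ hρ0⟩)

end MatrixJost

/-! ### Connection coefficients as Wronskians at the origin -/

section Coefficients

open scoped ComplexConjugate

variable {R : Type*} [CStarAlgebra R] {q r : ℝ → R}

/-- The coefficient of `F(x, -ρ)` in the expansion of the reflected Jost solution of `r`. -/
def transCoeff (hq : Integrable q) (hr : Integrable r) (ρ : ℂ) : R :=
  (2 * Complex.I * ρ)⁻¹ • (star (jost' hq (-conj ρ) 0) * jost hr ρ 0 +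
    star (jost hq (-conj ρ) 0) * jost' hr ρ 0)

/-- The coefficient of `F(x, ρ)` in the expansion of the reflected Jost solution of `r`. -/
def reflCoeff (hq : Integrable q) (hr : Integrable r) (ρ : ℂ) : R :=
  (-(2 * Complex.I * ρ)⁻¹) • (star (jost' hq ρ 0) * jost hr ρ 0 +
    star (jost hq ρ 0) * jost' hr ρ 0)

/-- The source of `D(ρ) = A(-ρ̄)*`: the adjoint exchanges the two summands, and with them the roles
of the potential and its reflection. -/
theorem star_transCoeff (hq : Integrable q) (hr : Integrable r) (ρ : ℂ) :
    star (transCoeff hq hr ρ) = transCoeff hr hq (-conj ρ) := by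
  have e : (2 * Complex.I * (-conj ρ))⁻¹ = conj ((2 * Complex.I * ρ)⁻¹) := by
    simp [Complex.conj_ofNat]
  have e2 : ∀ (c : ℂ) (a : R), star (c • a) = conj c • star a := star_smul
  rw [transCoeff, transCoeff, e2, e, star_add, star_mul, star_mul, star_star, star_star, map_neg,
    Complex.conj_conj, neg_neg, add_comm]

/-- The source of `C(ρ)* = -B(ρ)`: the summands are exchanged as in `star_transCoeff`, while the
scalar prefactor is purely imaginary and changes sign. -/
theorem star_reflCoeff (hq : Integrable q) (hr : Integrable r) (ρ : ℝ) :
    star (reflCoeff hq hr ρ) = (-reflCoeff hr hq ρ : R) := by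
  have e : conj ((-(2 * Complex.I * (ρ : ℂ))⁻¹)) = (2 * Complex.I * (ρ : ℂ))⁻¹ := by
    simp [Complex.conj_ofNat]
  have e2 : ∀ (c : ℂ) (a : R), star (c • a) = conj c • star a := star_smul
  rw [reflCoeff, reflCoeff, e2, e, star_add, star_mul, star_mul, star_star, star_star, neg_smul,
    neg_neg, add_comm]

theorem isSol_jost_reflect (hr : Integrable r) (hrq : ∀ x, r (-x) = q x) {ρ : ℂ}
    (hρ : 0 ≤ ρ.im) (hρ0 : ρ ≠ 0) :
    IsSol q (ρ ^ 2) (fun x => jost hr ρ (-x)) (fun x => -jost' hr ρ (-x)) := by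
  have := (isSol_jost hr hρ hρ0).comp_neg
  simpa only [hrq] using this

variable (hq : Integrable q) (hs : ∀ᵐ x, star (q x) = q x) {ρ : ℝ} (hρ0 : ρ ≠ 0)

include hs hρ0

theorem starWronskian_jost_real (x : ℝ) :
    starWronskian (jost hq ρ) (jost' hq ρ) (jost hq ρ) (jost' hq ρ) x =
      (-(2 * Complex.I * ρ)) • (1 : R) ∧
    starWronskian (jost hq (-ρ)) (jost' hq (-ρ)) (jost hq (-ρ)) (jost' hq (-ρ)) x =
      (2 * Complex.I * ρ) • (1 : R) ∧
    starWronskian (jost hq ρ) (jost' hq ρ) (jost hq (-ρ)) (jost' hq (-ρ)) x = (0 : R) ∧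
    starWronskian (jost hq (-ρ)) (jost' hq (-ρ)) (jost hq ρ) (jost' hq ρ) x = (0 : R) := by
  have hρc : (ρ : ℂ) ≠ 0 := by exact_mod_cast hρ0
  refine ⟨starWronskian_jost_self hq hs hρ0 x, ?_, ?_, ?_⟩
  · have := starWronskian_jost_self hq hs (neg_ne_zero.mpr hρ0) x
    push_cast at this
    rw [this]
    congr 1
    ring
  · have := starWronskian_jost_neg_conj hq hs (ρ := -(ρ : ℂ)) (by simp) (neg_ne_zero.mpr hρc) x
    simpa using this
  · have := starWronskian_jost_neg_conj hq hs (ρ := (ρ : ℂ)) (by simp) hρc x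
    simpa using this

/-- Pairing with `F(ρ)` or `F(-ρ)` isolates one coefficient, because the mixed Wronskians vanish and
the diagonal ones are scalars. -/
theorem coeffs_eq_of_expansion {Y Y' : ℝ → R} {C D : R} (hY : ∀ x, HasDerivAt Y (Y' x) x)
    (h : ∀ x, Y x = jost hq ρ x * C + jost hq (-ρ) x * D) (x : ℝ) :
    starWronskian (jost hq ρ) (jost' hq ρ) Y Y' x = (-(2 * Complex.I * ρ)) • C ∧
    starWronskian (jost hq (-ρ)) (jost' hq (-ρ)) Y Y' x = (2 * Complex.I * ρ) • D ∧
    starWronskian Y Y' Y Y' x =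
      (2 * Complex.I * ρ) • (star D * D) - (2 * Complex.I * ρ) • (star C * C) := by
  have hρc : (ρ : ℂ) ≠ 0 := by exact_mod_cast hρ0
  have h1 := isSol_jost hq (ρ := (ρ : ℂ)) (by simp) hρc
  have h2 := isSol_jost hq (ρ := -(ρ : ℂ)) (by simp) (neg_ne_zero.mpr hρc)
  have hY' : Y' x = jost' hq ρ x * C + jost' hq (-ρ) x * D := by
    refine (hY x).unique ?_
    rw [funext h]
    exact ((h1.hasDerivAt x).mul_const C).add ((h2.hasDerivAt x).mul_const D)
  obtain ⟨w11, w22, w12, w21⟩ := starWronskian_jost_real hq hs hρ0 x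
  have hlin : ∀ Z Z' : ℝ → R, starWronskian Z Z' Y Y' x =
      starWronskian Z Z' (jost hq ρ) (jost' hq ρ) x * C +
      starWronskian Z Z' (jost hq (-ρ)) (jost' hq (-ρ)) x * D := fun Z Z' => by
    simp only [starWronskian, h x, hY']
    noncomm_ring
  have e1 : starWronskian (jost hq ρ) (jost' hq ρ) Y Y' x = (-(2 * Complex.I * ρ)) • C := by
    rw [hlin, w11, w12, zero_mul, add_zero, smul_mul_assoc, one_mul]
  have e2 : starWronskian (jost hq (-ρ)) (jost' hq (-ρ)) Y Y' x = (2 * Complex.I * ρ) • D := by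
    rw [hlin, w22, w21, zero_mul, zero_add, smul_mul_assoc, one_mul]
  refine ⟨e1, e2, ?_⟩
  have e3 : starWronskian Y Y' Y Y' x =
      star C * starWronskian (jost hq ρ) (jost' hq ρ) Y Y' x +
      star D * starWronskian (jost hq (-ρ)) (jost' hq (-ρ)) Y Y' x := by
    simp only [starWronskian]
    have eY : star (Y x) = star C * star (jost hq ρ x) + star D * star (jost hq (-ρ) x) := by
      rw [h x, star_add, star_mul, star_mul]
    have eY' : star (Y' x) = star C * star (jost' hq ρ x) + star D * star (jost' hq (-ρ) x) := by
      rw [hY', star_add, star_mul, star_mul]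
    rw [eY, eY']
    noncomm_ring
  rw [e3, e1, e2, mul_smul_comm, mul_smul_comm]
  module

theorem reflect_coeffs_unique (hr : Integrable r) (hrq : ∀ x, r (-x) = q x) {C D : R}
    (h : ∀ x, jost hr ρ (-x) = jost hq ρ x * C + jost hq (-ρ) x * D) :
    C = reflCoeff hq hr ρ ∧ D = transCoeff hq hr ρ := by
  have hρc : (ρ : ℂ) ≠ 0 := by exact_mod_cast hρ0
  have h2ρ : (2 * Complex.I * ρ) ≠ 0 := by simp [hρ0]
  obtain ⟨e1, e2, -⟩ := coeffs_eq_of_expansion hq hs hρ0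
    (isSol_jost_reflect hr hrq (ρ := (ρ : ℂ)) (by simp) hρc).hasDerivAt h 0
  rw [starWronskian, neg_zero, mul_neg, sub_neg_eq_add] at e1 e2
  refine ⟨?_, ?_⟩
  · rw [reflCoeff, e1, smul_smul, neg_mul_neg, inv_mul_cancel₀ h2ρ, one_smul]
  · rw [transCoeff, Complex.conj_ofReal, e2, smul_smul, inv_mul_cancel₀ h2ρ, one_smul]

/-- The self-Wronskian of the reflected Jost solution is computed in two ways, from its expansion
and from its own asymptotics; reflection reverses the sign of the latter. -/
theorem star_transCoeff_mul_self (hr : Integrable r) (hsr : ∀ᵐ x, star (r x) = r x)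
    (hrq : ∀ x, r (-x) = q x)
    (h : ∀ x, jost hr ρ (-x) = jost hq ρ x * reflCoeff hq hr ρ + jost hq (-ρ) x *
      transCoeff hq hr ρ) :
    star (transCoeff hq hr ρ) * transCoeff hq hr ρ =
      1 + star (reflCoeff hq hr ρ) * reflCoeff hq hr ρ := by
  have hρc : (ρ : ℂ) ≠ 0 := by exact_mod_cast hρ0
  have h2ρ : (2 * Complex.I * ρ) ≠ 0 := by simp [hρ0]
  obtain ⟨-, -, e3⟩ := coeffs_eq_of_expansion hq hs hρ0
    (isSol_jost_reflect hr hrq (ρ := (ρ : ℂ)) (by simp) hρc).hasDerivAt h 0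
  have w := starWronskian_jost_self hr hsr hρ0 0
  have e4 : starWronskian (fun x => jost hr ρ (-x)) (fun x => -jost' hr ρ (-x))
      (fun x => jost hr ρ (-x)) (fun x => -jost' hr ρ (-x)) 0 = (2 * Complex.I * ρ) • (1 : R) := by
    have : starWronskian (fun x => jost hr ρ (-x)) (fun x => -jost' hr ρ (-x))
        (fun x => jost hr ρ (-x)) (fun x => -jost' hr ρ (-x)) 0 =
        -starWronskian (jost hr ρ) (jost' hr ρ) (jost hr ρ) (jost' hr ρ) 0 := by
      simp only [starWronskian, neg_zero, star_neg]
      noncomm_ring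
    rw [this, w, neg_smul, neg_neg]
  rw [e4, ← smul_sub] at e3
  have := smul_right_injective R h2ρ e3
  rw [this]
  abel

end Coefficients

/-! ### Existence of the expansion and invertibility for real `ρ` -/

section Scattering

open scoped Matrix.Norms.L2Operator ComplexConjugate ComplexOrder

variable {m : ℕ} {q r : ℝ → Matrix (Fin m) (Fin m) ℂ}

/-- The four Wronskian identities exhibit a left inverse of the block matrix built from `F(±ρ)` and
its derivatives. In finite dimension it is also a right inverse, and the first block row of that
identity gives the expansion of `Y`. -/
theorem expansion_jost (hq : Integrable q) (hs : ∀ᵐ x, star (q x) = q x) {ρ : ℝ} (hρ0 : ρ ≠ 0)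
    {Y Y' : ℝ → Matrix (Fin m) (Fin m) ℂ} (hY : IsSol q ((ρ : ℂ) ^ 2) Y Y') (x : ℝ) :
    Y x = jost hq ρ x * ((-(2 * Complex.I * ρ)⁻¹) •
        starWronskian (jost hq ρ) (jost' hq ρ) Y Y' 0) +
      jost hq (-ρ) x * ((2 * Complex.I * ρ)⁻¹ •
        starWronskian (jost hq (-ρ)) (jost' hq (-ρ)) Y Y' 0) := by
  have hρc : (ρ : ℂ) ≠ 0 := by exact_mod_cast hρ0
  have h2ρ : (2 * Complex.I * ρ) ≠ 0 := by simp [hρ0]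
  have h1 := isSol_jost hq (ρ := (ρ : ℂ)) (by simp) hρc
  have h2 := isSol_jost hq (ρ := -(ρ : ℂ)) (by simp) (neg_ne_zero.mpr hρc)
  obtain ⟨w11, w22, w12, w21⟩ := starWronskian_jost_real hq hs hρ0 x
  rw [starWronskian_eq hs (by simp) hY h1 0 x, starWronskian_eq hs (by simp) hY h2 0 x]
  simp only [starWronskian] at w11 w22 w12 w21 ⊢
  set c : ℂ := (2 * Complex.I * ρ)⁻¹ with hc
  set F₁ := jost hq ρ x
  set F₂ := jost hq (-ρ) x
  set F₁' := jost' hq ρ x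
  set F₂' := jost' hq (-ρ) x
  have hLW : Matrix.fromBlocks (c • -star F₁') (c • star F₁) (c • star F₂') (c • -star F₂) *
      Matrix.fromBlocks F₁ F₂ F₁' F₂' = 1 := by
    rw [Matrix.fromBlocks_multiply, ← Matrix.fromBlocks_one]
    simp only [smul_mul_assoc, neg_mul, ← smul_add]
    congr 1
    · rw [neg_add_eq_sub, ← neg_sub, w11, neg_smul, neg_neg, smul_smul, hc,
        inv_mul_cancel₀ h2ρ, one_smul]
    · rw [neg_add_eq_sub, ← neg_sub, w12, neg_zero, smul_zero]
    · rw [← sub_eq_add_neg, w21, smul_zero]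
    · rw [← sub_eq_add_neg, w22, smul_smul, hc, inv_mul_cancel₀ h2ρ, one_smul]
  have hWL := mul_eq_one_comm.mp hLW
  rw [Matrix.fromBlocks_multiply, ← Matrix.fromBlocks_one, Matrix.fromBlocks_inj] at hWL
  obtain ⟨h11, h12, -, -⟩ := hWL
  calc Y x = (F₁ * (c • -star F₁') + F₂ * (c • star F₂')) * Y x +
        (F₁ * (c • star F₁) + F₂ * (c • -star F₂)) * Y' x := by
          rw [h11, h12, one_mul, zero_mul, add_zero]
    _ = _ := by
          simp only [mul_smul_comm, smul_mul_assoc, neg_smul, mul_neg, neg_mul, smul_neg, mul_sub,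
            add_mul, smul_sub, mul_assoc]
          abel

variable (hq : Integrable q) (hr : Integrable r) (hs : ∀ᵐ x, star (q x) = q x)
  (hsr : ∀ᵐ x, star (r x) = r x) (hrq : ∀ x, r (-x) = q x) {ρ : ℝ} (hρ0 : ρ ≠ 0)

include hs hrq hρ0

theorem jost_reflect_expansion (x : ℝ) :
    jost hr ρ (-x) = jost hq ρ x * reflCoeff hq hr ρ + jost hq (-ρ) x * transCoeff hq hr ρ := by
  have hρc : (ρ : ℂ) ≠ 0 := by exact_mod_cast hρ0
  have := expansion_jost hq hs hρ0
    (isSol_jost_reflect hr hrq (ρ := (ρ : ℂ)) (by simp) hρc) x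
  simpa only [starWronskian, reflCoeff, transCoeff, Complex.conj_ofReal, neg_zero, mul_neg,
    sub_neg_eq_add] using this

include hsr

/-- By `star_transCoeff_mul_self`, `D*D = 1 + C*C` is positive definite, so `D` has nonzero
determinant. -/
theorem isUnit_transCoeff : IsUnit (transCoeff hq hr ρ) := by
  have h := star_transCoeff_mul_self hq hs hρ0 hr hsr hrq (jost_reflect_expansion hq hr hs hrq hρ0)
  have hp : (1 + star (reflCoeff hq hr ρ) * reflCoeff hq hr ρ).PosDef :=
    Matrix.PosDef.one.add_posSemidef (Matrix.posSemidef_conjTranspose_mul_self _)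
  rw [← h] at hp
  have hu := hp.isUnit
  rw [Matrix.isUnit_iff_isUnit_det, Matrix.det_mul] at hu
  rw [Matrix.isUnit_iff_isUnit_det]
  exact isUnit_of_mul_isUnit_right hu

end Scattering

/-! ### Coefficients and scattering matrices on the real axis -/

section RealAxis

open scoped Matrix.Norms.L2Operator ComplexConjugate

variable {m : ℕ} {Q : ℝ → Matrix (Fin m) (Fin m) ℂ}

theorem ae_star_comp_neg (hs : ∀ᵐ x, star (Q x) = Q x) : ∀ᵐ x, star (Q (-x)) = Q (-x) :=
  (Measure.measurePreserving_neg (volume : Measure ℝ)).quasiMeasurePreserving.ae hs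

variable (hq : Integrable Q) (hs : ∀ᵐ x, star (Q x) = Q x) {ρ : ℝ} (hρ0 : ρ ≠ 0)

include hq hs hρ0

theorem isLeftCoeffs_iff (p : Matrix (Fin m) (Fin m) ℂ × Matrix (Fin m) (Fin m) ℂ) :
    IsLeftCoeffs Q ρ p ↔ p = (transCoeff hq.comp_neg hq ρ, reflCoeff hq.comp_neg hq ρ) := by
  have hρc : (ρ : ℂ) ≠ 0 := by exact_mod_cast hρ0
  rw [IsLeftCoeffs, jostPlus_eq hq (by simp) hρc, jostMinus_eq hq (by simp) hρc,
    jostMinus_eq hq (by simp) (neg_ne_zero.mpr hρc)]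
  constructor
  · intro h
    have := reflect_coeffs_unique hq.comp_neg (ae_star_comp_neg hs) hρ0 hq (fun x => rfl)
      (C := p.2) (D := p.1) fun x => by
        rw [h (-x), add_comm]
        simp only [neg_neg]
    exact Prod.ext this.2 this.1
  · rintro rfl x
    have := jost_reflect_expansion hq.comp_neg hq (ae_star_comp_neg hs) (fun x => rfl) hρ0 (-x)
    rw [neg_neg] at this
    rw [this, add_comm]

theorem isRightCoeffs_iff (p : Matrix (Fin m) (Fin m) ℂ × Matrix (Fin m) (Fin m) ℂ) :
    IsRightCoeffs Q ρ p ↔ p = (reflCoeff hq hq.comp_neg ρ, transCoeff hq hq.comp_neg ρ) := by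
  have hρc : (ρ : ℂ) ≠ 0 := by exact_mod_cast hρ0
  rw [IsRightCoeffs, jostMinus_eq hq (by simp) hρc, jostPlus_eq hq (by simp) hρc,
    jostPlus_eq hq (by simp) (neg_ne_zero.mpr hρc)]
  constructor
  · intro h
    have := reflect_coeffs_unique hq hs hρ0 hq.comp_neg (fun x => by simp)
      (C := p.1) (D := p.2) h
    exact Prod.ext this.1 this.2
  · rintro rfl x
    exact jost_reflect_expansion hq hq.comp_neg hs (fun x => by simp) hρ0 x

theorem existsUnique_isLeftCoeffs : ∃! p, IsLeftCoeffs Q ρ p :=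
  ⟨_, (isLeftCoeffs_iff hq hs hρ0 _).mpr rfl, fun p h => (isLeftCoeffs_iff hq hs hρ0 p).mp h⟩

theorem existsUnique_isRightCoeffs : ∃! p, IsRightCoeffs Q ρ p :=
  ⟨_, (isRightCoeffs_iff hq hs hρ0 _).mpr rfl, fun p h => (isRightCoeffs_iff hq hs hρ0 p).mp h⟩

theorem epsilon_isLeftCoeffs : Classical.epsilon (IsLeftCoeffs Q ρ) =
    (transCoeff hq.comp_neg hq ρ, reflCoeff hq.comp_neg hq ρ) :=
  (isLeftCoeffs_iff hq hs hρ0 _).mp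
    (Classical.epsilon_spec ⟨_, (isLeftCoeffs_iff hq hs hρ0 _).mpr rfl⟩)

theorem epsilon_isRightCoeffs : Classical.epsilon (IsRightCoeffs Q ρ) =
    (reflCoeff hq hq.comp_neg ρ, transCoeff hq hq.comp_neg ρ) :=
  (isRightCoeffs_iff hq hs hρ0 _).mp
    (Classical.epsilon_spec ⟨_, (isRightCoeffs_iff hq hs hρ0 _).mpr rfl⟩)

theorem coeffA_real : coeffA Q ρ = transCoeff hq.comp_neg hq ρ := by
  rw [coeffA, if_pos (Complex.ofReal_im ρ), epsilon_isLeftCoeffs hq hs hρ0]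

theorem coeffB_real : coeffB Q ρ = reflCoeff hq.comp_neg hq ρ := by
  rw [coeffB, epsilon_isLeftCoeffs hq hs hρ0]

theorem coeffC_real : coeffC Q ρ = reflCoeff hq hq.comp_neg ρ := by
  rw [coeffC, epsilon_isRightCoeffs hq hs hρ0]

theorem coeffD_real : coeffD Q ρ = transCoeff hq hq.comp_neg ρ := by
  rw [coeffD, if_pos (Complex.ofReal_im ρ), epsilon_isRightCoeffs hq hs hρ0]

theorem isUnit_coeffA : IsUnit (coeffA Q ρ) := by
  rw [coeffA_real hq hs hρ0]
  exact isUnit_transCoeff hq.comp_neg hq (ae_star_comp_neg hs) hs (fun x => rfl) hρ0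

theorem isUnit_coeffD : IsUnit (coeffD Q ρ) := by
  rw [coeffD_real hq hs hρ0]
  exact isUnit_transCoeff hq hq.comp_neg hs (ae_star_comp_neg hs) (fun x => by simp) hρ0

/-- With `D(-ρ)* = A(ρ)` and `C(ρ)* = -B(ρ)`, the factor `D*` cancels the inverse `(D*)⁻¹` inside
`S₊*`, and `B A⁻¹` remains. -/
theorem scatMinus_eq : scatMinus Q ρ =
    -((coeffD Q ρ)ᴴ * (scatPlus Q ρ)ᴴ * ((coeffD Q (-ρ))ᴴ)⁻¹) := by
  have hD := isUnit_coeffD hq hs hρ0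
  have hDn : (coeffD Q (-ρ))ᴴ = coeffA Q ρ := by
    have h1 := coeffD_real hq hs (neg_ne_zero.mpr hρ0)
    push_cast at h1
    rw [h1, coeffA_real hq hs hρ0, ← Matrix.star_eq_conjTranspose, star_transCoeff]
    simp
  have hC : (coeffC Q ρ)ᴴ = -coeffB Q ρ := by
    rw [coeffC_real hq hs hρ0, coeffB_real hq hs hρ0, ← Matrix.star_eq_conjTranspose,
      star_reflCoeff]
  have hDD : (coeffD Q ρ)ᴴ * ((coeffD Q ρ)ᴴ)⁻¹ = 1 := by
    refine Matrix.mul_nonsing_inv _ ?_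
    rw [← Matrix.isUnit_iff_isUnit_det]
    exact hD.star
  rw [hDn, scatPlus, scatMinus, Matrix.conjTranspose_mul, Matrix.conjTranspose_nonsing_inv, hC,
    ← mul_assoc, hDD, one_mul, neg_mul, neg_neg]

end RealAxis

/-! ### Bound states on the imaginary axis -/

section BoundStates

open scoped ComplexConjugate

variable {R : Type*} [CStarAlgebra R] {q r : ℝ → R}

theorem star_jostGram (hq : Integrable q) (ρ : ℂ) : star (jostGram hq ρ) = jostGram hq ρ := by
  have h := ((starL' ℝ : R ≃L[ℝ] R)).integral_comp_comm (μ := volume.restrict (Set.Ioi (0 : ℝ)))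
    (fun x => star (jost hq ρ x) * jost hq ρ x)
  refine h.symm.trans ?_
  simp [jostGram, starL'_apply]

/-- Two conjugations compose to a holomorphic dependence, which makes the starred factors in
`transCoeff` differentiable in the spectral parameter. -/
theorem hasDerivAt_star_neg_conj {f : ℂ → R} {f' : R} {ρ : ℂ} (hf : HasDerivAt f f' ρ)
    (hρ : -conj ρ = ρ) : HasDerivAt (fun z => star (f (-conj z))) (-star f') ρ := by
  have h1 : HasDerivAt (fun z => f (-z)) (-f') (conj ρ) := by
    have : HasDerivAt f f' (-conj ρ) := by rwa [hρ]
    have h := this.scomp (conj ρ) (hasDerivAt_neg (conj ρ))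
    rwa [neg_one_smul] at h
  have h2 := h1.star_conj
  rw [Complex.conj_conj, star_neg] at h2
  exact h2

variable (hq : Integrable q) (hr : Integrable r) {ρ : ℂ}

theorem deriv_relation (hrq : ∀ x, r (-x) = q x) (hρ : 0 ≤ ρ.im) (hρ0 : ρ ≠ 0) {V W : R}
    (h : ∀ x, jost hq ρ x * V = jost hr ρ (-x) * W) :
    jost' hq ρ 0 * V = -(jost' hr ρ 0 * W) := by
  have h1 := ((isSol_jost hq hρ hρ0).hasDerivAt 0).mul_const V
  have h2 := ((isSol_jost_reflect hr hrq hρ hρ0).hasDerivAt 0).mul_const W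
  rw [funext h] at h1
  have := h1.unique h2
  rwa [neg_zero, neg_mul] at this

/-- `A V` is, up to a scalar, the Wronskian of the dual of `F₋` with `F₊ V`; once `F₊ V = F₋ W`, it
vanishes because `F₋` has zero Wronskian with its own dual. -/
theorem transCoeff_mul_eq_zero (hrq : ∀ x, r (-x) = q x) (hsr : ∀ᵐ x, star (r x) = r x)
    (hρ : 0 < ρ.im) (hc : -conj ρ = ρ) {V W : R}
    (h : ∀ x, jost hq ρ x * V = jost hr ρ (-x) * W) : transCoeff hr hq ρ * V = 0 := by
  have hρ0 : ρ ≠ 0 := fun h => by simp [h] at hρ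
  have h0 := h 0
  rw [neg_zero] at h0
  have h1 := deriv_relation hq hr hrq hρ.le hρ0 h
  have w := starWronskian_jost_neg_conj hr hsr hρ.le hρ0 0
  rw [hc, starWronskian] at w
  rw [transCoeff, hc, smul_mul_assoc, add_mul, mul_assoc (star _), mul_assoc (star _), h0, h1, mul_neg,
    ← sub_eq_add_neg, ← mul_assoc, ← mul_assoc, ← sub_mul, w, zero_mul, smul_zero]

theorem star_mul_transCoeff_eq_zero (hrq : ∀ x, r (-x) = q x) (hs : ∀ᵐ x, star (q x) = q x)
    (hρ : 0 < ρ.im) (hc : -conj ρ = ρ) {V W : R}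
    (h : ∀ x, jost hq ρ x * V = jost hr ρ (-x) * W) : star W * transCoeff hr hq ρ = 0 := by
  have := transCoeff_mul_eq_zero hr hq (V := W) (W := V) (fun x => by rw [← hrq, neg_neg]) hs hρ hc
    (fun x => by rw [h (-x), neg_neg])
  have h2 := congrArg star this
  rwa [star_mul, star_transCoeff, hc, star_zero] at h2

/-- Here `A V = 0` says that `F₊ V` has zero Wronskian with the dual of `F₋`; `exists_eq_jost_mul`,
applied after reflection, makes it a multiple of `F₋`. -/
theorem exists_relation_of_transCoeff_mul_eq_zero (hrq : ∀ x, r (-x) = q x)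
    (hsr : ∀ᵐ x, star (r x) = r x) (hρ : 0 < ρ.im) {V : R}
    (h : transCoeff hr hq ρ * V = 0) : ∃ W, ∀ x, jost hq ρ x * V = jost hr ρ (-x) * W := by
  have hρ0 : ρ ≠ 0 := fun h => by simp [h] at hρ
  have h2ρ : (2 * Complex.I * ρ)⁻¹ ≠ 0 := by simp [hρ0]
  have hS := (isSol_jost_reflect hq (q := r) (fun x => by rw [← hrq, neg_neg]) hρ.le hρ0).mul_const V
  have hw0 : starWronskian (jost hr (-conj ρ)) (jost' hr (-conj ρ)) (fun x => jost hq ρ (-x) * V)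
      (fun x => -jost' hq ρ (-x) * V) 0 = 0 := by
    rw [transCoeff, smul_mul_assoc] at h
    have := (smul_eq_zero.mp h).resolve_left h2ρ
    rw [← this, starWronskian, neg_zero]
    noncomm_ring
  have hZ := isSol_jost hr (ρ := -conj ρ) (by simpa using hρ.le) (by simpa using hρ0)
  obtain ⟨W, hW⟩ := exists_eq_jost_mul hr hsr hρ.le hρ0 hS fun x => by
    rw [starWronskian_eq hsr (sq_neg_conj ρ).symm hS hZ x 0, hw0]
  exact ⟨W, fun x => by rw [← hW (-x), neg_neg]⟩

/-- In `W* A' V` the relation `F₊ V = F₋ W` replaces each undifferentiated Jost solution by the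
other one. Two Wronskians of a Jost solution with its own spectral derivative remain, and these are
Gram integrals over the two half-lines. The bracket is therefore the integral of `(F₊V)*(F₊V)` over
the whole line. -/
theorem exists_hasDerivAt_transCoeff (hrq : ∀ x, r (-x) = q x) (hs : ∀ᵐ x, star (q x) = q x)
    (hsr : ∀ᵐ x, star (r x) = r x) (hρ : 0 < ρ.im) (hc : -conj ρ = ρ) :
    ∃ A : R, HasDerivAt (fun z => transCoeff hr hq z) A ρ ∧
      ∀ V W, (∀ x, jost hq ρ x * V = jost hr ρ (-x) * W) →
        star W * A * V = (-Complex.I) •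
          (star V * jostGram hq ρ * V + star W * jostGram hr ρ * W) := by
  have hρ0 : ρ ≠ 0 := fun h => by simp [h] at hρ
  have h2ρ : 2 * Complex.I * ρ ≠ 0 := by simp [hρ0]
  have hcρ : conj ρ = -ρ := neg_eq_iff_eq_neg.mp hc
  have hsq : conj (ρ ^ 2) = ρ ^ 2 := by rw [map_pow, hcρ, neg_sq]
  have hf := (differentiableAt_jost hq hρ 0).hasDerivAt
  have hg := (differentiableAt_jost' hq hρ 0).hasDerivAt
  have hk := (differentiableAt_jost hr hρ 0).hasDerivAt
  have hl := (differentiableAt_jost' hr hρ 0).hasDerivAt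
  set f₁ := deriv (fun z => jost hq z 0) ρ
  set g₁ := deriv (fun z => jost' hq z 0) ρ
  set k₁ := deriv (fun z => jost hr z 0) ρ
  set l₁ := deriv (fun z => jost' hr z 0) ρ
  have eq : star (jost' hq ρ 0) * f₁ - star (jost hq ρ 0) * g₁ = -((2 * ρ) • jostGram hq ρ) :=
    ((hf.const_mul _).sub (hg.const_mul _)).unique (hasDerivAt_starWronskian_jost hq hs hρ hsq)
  have er : star (jost' hr ρ 0) * k₁ - star (jost hr ρ 0) * l₁ = -((2 * ρ) • jostGram hr ρ) :=
    ((hk.const_mul _).sub (hl.const_mul _)).unique (hasDerivAt_starWronskian_jost hr hsr hρ hsq)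
  have hS := ((hasDerivAt_star_neg_conj hl hc).mul hf).add
    ((hasDerivAt_star_neg_conj hk hc).mul hg)
  have hcd : DifferentiableAt ℂ (fun z : ℂ => (2 * Complex.I * z)⁻¹) ρ :=
    (differentiableAt_id.const_mul _).inv h2ρ
  refine ⟨_, hcd.hasDerivAt.smul hS, fun V W h => ?_⟩
  have h0 : jost hq ρ 0 * V = jost hr ρ 0 * W := by simpa using h 0
  have h1 := deriv_relation hq hr hrq hρ.le hρ0 h
  have hz := star_mul_transCoeff_eq_zero hq hr hrq hs hρ hc h
  rw [transCoeff, mul_smul_comm] at hz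
  have hz' := (smul_eq_zero.mp hz).resolve_left (inv_ne_zero h2ρ)
  have e2 : ∀ (c : ℂ) (a : R), star (c • a) = conj c • star a := star_smul
  have erW : star W * star l₁ * jost hr ρ 0 * W - star W * star k₁ * jost' hr ρ 0 * W =
      -((2 * ρ) • (star W * jostGram hr ρ * W)) := by
    have h2 := congrArg star er
    rw [star_sub, star_mul, star_mul, star_star, star_star, star_neg, e2, star_jostGram, map_mul,
      hcρ, Complex.conj_ofNat, mul_neg, neg_smul, neg_neg] at h2
    have h3 := congrArg (fun X => star W * X * W) h2
    simp only [mul_smul_comm, smul_mul_assoc] at h3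
    rw [← h3]
    noncomm_ring
  have eqV : star V * star (jost' hq ρ 0) * f₁ * V - star V * star (jost hq ρ 0) * g₁ * V =
      -((2 * ρ) • (star V * jostGram hq ρ * V)) := by
    have h3 := congrArg (fun X => star V * X * V) eq
    simp only [mul_smul_comm, smul_mul_assoc, mul_neg, neg_mul] at h3
    rw [← h3]
    noncomm_ring
  have s0 : star W * star (jost hr ρ 0) = star V * star (jost hq ρ 0) := by
    rw [← star_mul, ← star_mul, h0]
  have s1 : star W * star (jost' hr ρ 0) = -(star V * star (jost' hq ρ 0)) := by
    rw [← star_mul, ← star_mul, h1, star_neg, neg_neg]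
  have key : star W * (-star l₁ * jost hq ρ 0 + star (jost' hr (-conj ρ) 0) * f₁ +
      (-star k₁ * jost' hq ρ 0 + star (jost hr (-conj ρ) 0) * g₁)) * V =
      (2 * ρ) • (star V * jostGram hq ρ * V + star W * jostGram hr ρ * W) := by
    rw [hc]
    calc _ = -(star W * star l₁ * (jost hq ρ 0 * V)) - star W * star k₁ * (jost' hq ρ 0 * V) +
          (star W * star (jost' hr ρ 0)) * f₁ * V + (star W * star (jost hr ρ 0)) * g₁ * V := by
            noncomm_ring
      _ = -(star W * star l₁ * jost hr ρ 0 * W - star W * star k₁ * jost' hr ρ 0 * W) -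
          (star V * star (jost' hq ρ 0) * f₁ * V - star V * star (jost hq ρ 0) * g₁ * V) := by
            rw [h0, h1, s0, s1]
            noncomm_ring
      _ = _ := by
            rw [erW, eqV]
            module
  rw [mul_add, add_mul, mul_smul_comm, mul_smul_comm, smul_mul_assoc, smul_mul_assoc]
  erw [key]
  -- The term from differentiating the prefactor `(2iz)⁻¹` drops out because `W* A(ρ) = 0`.
  rw [hz', zero_mul, smul_zero, add_zero, smul_smul]
  congr 1
  rw [← mul_right_inj' h2ρ, ← mul_assoc, mul_inv_cancel₀ h2ρ]
  linear_combination (2 * ρ) * Complex.I_mul_I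

end BoundStates

/-! ### Simple poles, pseudo-inverses and positivity of the Gram matrix -/

section LinearAlgebra

open scoped Matrix.Norms.L2Operator ComplexConjugate ComplexOrder

variable {m : ℕ}

/-- A projection onto the kernel of a matrix. -/
theorem exists_kernel_projection (B : Matrix (Fin m) (Fin m) ℂ) :
    ∃ P : Matrix (Fin m) (Fin m) ℂ, B * P = 0 ∧
      ∀ V : Matrix (Fin m) (Fin m) ℂ, B * V = 0 → P * V = V := by
  obtain ⟨g, hg⟩ := LinearMap.exists_leftInverse_of_injective
    (LinearMap.ker (Matrix.toLin' B)).subtype (Submodule.ker_subtype _)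
  refine ⟨LinearMap.toMatrix' ((LinearMap.ker (Matrix.toLin' B)).subtype ∘ₗ g), ?_, fun V hV => ?_⟩
  · apply Matrix.toLin'.injective
    rw [Matrix.toLin'_mul, Matrix.toLin'_toMatrix', map_zero]
    rw [← LinearMap.comp_assoc, LinearMap.comp_ker_subtype, LinearMap.zero_comp]
  · apply Matrix.toLin'.injective
    rw [Matrix.toLin'_mul, Matrix.toLin'_toMatrix']
    refine LinearMap.ext fun x => ?_
    have hx : Matrix.toLin' V x ∈ LinearMap.ker (Matrix.toLin' B) := by
      rw [LinearMap.mem_ker, ← LinearMap.comp_apply, ← Matrix.toLin'_mul, hV, map_zero,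
        LinearMap.zero_apply]
    have := LinearMap.congr_fun hg ⟨_, hx⟩
    exact congrArg Subtype.val this

theorem isUnit_of_mul_eq_zero {M : Matrix (Fin m) (Fin m) ℂ}
    (h : ∀ X : Matrix (Fin m) (Fin m) ℂ, M * X = 0 → X = 0) : IsUnit M := by
  by_contra hM
  have hdet : M.det = 0 := by
    rwa [Matrix.isUnit_iff_isUnit_det, isUnit_iff_ne_zero, not_not] at hM
  obtain ⟨v, hv, hMv⟩ := Matrix.exists_mulVec_eq_zero_iff.mpr hdet
  refine hv (funext fun i => ?_)
  have h0 := h (Matrix.of fun i _ => v i) (by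
    ext i j
    exact congrFun hMv i)
  exact congrFun (congrFun h0 i) i

/-- The hypothesis `hinj` excludes Jordan chains of length two at `ρ`, which is what a pole of order
at least two would require. With `P` a projection onto the kernel of `A ρ`, the residue is `P M⁻¹`
for the invertible matrix `M = A ρ + A₁ P`. -/
theorem exists_residue {A : ℂ → Matrix (Fin m) (Fin m) ℂ} {A₁ : Matrix (Fin m) (Fin m) ℂ} {ρ : ℂ}
    (hA : HasDerivAt A A₁ ρ)
    (hinj : ∀ V Z, A ρ * V = 0 → A₁ * V = A ρ * Z → V = 0) :
    ∃ R, Tendsto (fun z => (z - ρ) • (A z)⁻¹) (𝓝[≠] ρ) (𝓝 R) ∧ A ρ * R = 0 ∧ R * A ρ = 0 ∧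
      ∀ X, A ρ * X = 0 → R * A₁ * X = X := by
  obtain ⟨P, hP0, hP⟩ := exists_kernel_projection (A ρ)
  have hPP : P * P = P := hP P hP0
  set M := A ρ + A₁ * P with hM
  have hMu : IsUnit M := by
    refine isUnit_of_mul_eq_zero fun X hX => ?_
    rw [hM, add_mul, mul_assoc] at hX
    have h1 : P * X = 0 := hinj (P * X) (-X) (by rw [← mul_assoc, hP0, zero_mul]) (by
      rw [mul_neg, eq_neg_iff_add_eq_zero, add_comm, hX])
    rw [h1, mul_zero, add_zero] at hX
    rw [← hP X hX, h1]
  have hMd : IsUnit M.det := (Matrix.isUnit_iff_isUnit_det M).mp hMu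
  have hMI : M * (1 - P) = A ρ := by
    rw [hM]
    have : (A ρ + A₁ * P) * (1 - P) = A ρ + A₁ * (P - P * P) - A ρ * P := by noncomm_ring
    rw [this, hPP, hP0, sub_self, mul_zero, add_zero, sub_zero]
  have hMA : M⁻¹ * A ρ = 1 - P := by
    rw [← hMI, ← mul_assoc, Matrix.nonsing_inv_mul M hMd, one_mul]
  have hslope := hasDerivAt_iff_tendsto_slope.mp hA
  have hcont : Tendsto A (𝓝[≠] ρ) (𝓝 (A ρ)) := hA.continuousAt.tendsto.mono_left nhdsWithin_le_nhds
  have hMz : Tendsto (fun z => A z * (1 - P) + slope A ρ z * P) (𝓝[≠] ρ) (𝓝 M) := by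
    have := (hcont.mul_const (1 - P)).add (hslope.mul_const P)
    rwa [mul_sub, mul_one, hP0, sub_zero, ← hM] at this
  obtain ⟨u, hu⟩ := hMu
  have hinv : Tendsto (fun z => (A z * (1 - P) + slope A ρ z * P)⁻¹) (𝓝[≠] ρ) (𝓝 M⁻¹) := by
    have h1 := NormedRing.inverse_continuousAt u
    rw [hu] at h1
    have := h1.tendsto.comp hMz
    simpa only [Function.comp_def, Matrix.nonsing_inv_eq_ringInverse] using this
  have hunit : ∀ᶠ z in 𝓝[≠] ρ, IsUnit (A z * (1 - P) + slope A ρ z * P) :=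
    hMz.eventually ((Units.isOpen (R := Matrix (Fin m) (Fin m) ℂ)).mem_nhds (hu ▸ u.isUnit))
  refine ⟨P * M⁻¹, ?_, by rw [← mul_assoc, hP0, zero_mul], ?_, fun X hX => ?_⟩
  · have hid : Tendsto (fun z : ℂ => z - ρ) (𝓝[≠] ρ) (𝓝 0) := by
      have : Tendsto (fun z : ℂ => z - ρ) (𝓝 ρ) (𝓝 (ρ - ρ)) := by
        exact (continuous_id.sub continuous_const).tendsto ρ
      rw [sub_self] at this
      exact this.mono_left nhdsWithin_le_nhds
    have hlim := (((hid.smul_const (1 - P)).add_const P).mul hinv)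
    rw [zero_smul, zero_add] at hlim
    refine hlim.congr' ?_
    filter_upwards [hunit, self_mem_nhdsWithin] with z hz hzρ
    have hz0 : z - ρ ≠ 0 := sub_ne_zero.mpr hzρ
    have hzd := (Matrix.isUnit_iff_isUnit_det _).mp hz
    set N := A z * (1 - P) + slope A ρ z * P with hN
    -- Dividing the kernel directions by `z - ρ` removes the degeneracy: `A(ρ) P = 0` turns `A(z) P
    -- / (z - ρ)` into a difference quotient, and `N` tends to the invertible `M`.
    have hAz : A z * ((1 - P) + (z - ρ)⁻¹ • P) = N := by
      rw [hN, slope, vsub_eq_sub, smul_mul_assoc, sub_mul, hP0, sub_zero, mul_add, mul_smul_comm]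
    have hr : A z * (((1 - P) + (z - ρ)⁻¹ • P) * N⁻¹) = 1 := by
      rw [← mul_assoc, hAz, Matrix.mul_nonsing_inv N hzd]
    rw [Matrix.inv_eq_right_inv hr, ← smul_mul_assoc, smul_add, smul_smul, mul_inv_cancel₀ hz0,
      one_smul]
  · rw [mul_assoc, hMA, mul_sub, mul_one, hPP, sub_self]
  · have h1 : A₁ * X = M * X := by
      rw [hM, add_mul, hX, zero_add, mul_assoc, hP X hX]
    rw [mul_assoc, h1, mul_assoc, ← mul_assoc M⁻¹, Matrix.nonsing_inv_mul M hMd, one_mul, hP X hX]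

theorem IsPseudoInverse.mul_mul_eq {N P : Matrix (Fin m) (Fin m) ℂ} (h : IsPseudoInverse N P) :
    N * P * N = N ∧ P * N * P = P ∧ star (N * P) = N * P ∧ N * P = P * N := by
  obtain ⟨U, hU, d, -, rfl, rfl⟩ := h
  have hU1 : U * Uᴴ = 1 := Matrix.mem_unitaryGroup_iff.mp hU
  have e : ∀ a b : Fin m → ℂ, (Uᴴ * Matrix.diagonal a * U) * (Uᴴ * Matrix.diagonal b * U) =
      Uᴴ * Matrix.diagonal (fun l => a l * b l) * U := fun a b => by
    rw [← Matrix.diagonal_mul_diagonal]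
    calc _ = Uᴴ * Matrix.diagonal a * (U * Uᴴ) * Matrix.diagonal b * U := by noncomm_ring
      _ = _ := by rw [hU1]; noncomm_ring
  have e1 : ∀ l, (d l : ℂ) * ((d l)⁻¹ : ℝ) * d l = d l := fun l => by
    by_cases hd : d l = 0 <;> simp [hd]
  have e2 : ∀ l, (((d l)⁻¹ : ℝ) : ℂ) * d l * ((d l)⁻¹ : ℝ) = ((d l)⁻¹ : ℝ) := fun l => by
    by_cases hd : d l = 0 <;> simp [hd]
  have e3 : ∀ l, (((d l)⁻¹ : ℝ) : ℂ) * d l = d l * ((d l)⁻¹ : ℝ) := fun l => mul_comm _ _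
  have e4 : ∀ l, (d l : ℂ) * ((d l)⁻¹ : ℝ) * ((d l)⁻¹ : ℝ) = ((d l)⁻¹ : ℝ) := fun l => by
    rw [← e3, e2]
  simp only [e, e1, e3, e4, true_and, and_true]
  rw [Matrix.star_eq_conjTranspose, Matrix.conjTranspose_mul, Matrix.conjTranspose_mul,
    Matrix.conjTranspose_conjTranspose, Matrix.diagonal_conjTranspose, ← mul_assoc]
  congr 3
  funext l
  simp

/-- The relations `NPN = N`, `PNP = P` and `NP = PN` determine `P`, whichever diagonalization
produced it. -/
theorem IsPseudoInverse.unique {N P P' : Matrix (Fin m) (Fin m) ℂ} (h : IsPseudoInverse N P)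
    (h' : IsPseudoInverse N P') : P = P' := by
  obtain ⟨-, a2, -, a4⟩ := h.mul_mul_eq
  obtain ⟨b1, b2, -, b4⟩ := h'.mul_mul_eq
  obtain ⟨a1, -⟩ := h.mul_mul_eq
  have e : N * P = N * P' := by
    calc N * P = N * P' * N * P := by rw [b1]
      _ = P' * (N * P * N) := by rw [b4, mul_assoc N P N, ← a4]; simp only [mul_assoc]
      _ = _ := by rw [a1, b4]
  calc P = P * (N * P) := by rw [← mul_assoc, a2]
    _ = P * N * P' := by rw [e, mul_assoc]
    _ = N * P' * P' := by rw [← a4, e]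
    _ = P' := by rw [b4, b2]

theorem exists_isPseudoInverse {N : Matrix (Fin m) (Fin m) ℂ} (h : N.PosSemidef) :
    ∃ P, IsPseudoInverse N P := by
  refine ⟨_, star (h.isHermitian.eigenvectorUnitary : Matrix (Fin m) (Fin m) ℂ), ?_,
    h.isHermitian.eigenvalues, h.eigenvalues_nonneg, ?_, rfl⟩
  · exact Unitary.star_mem h.isHermitian.eigenvectorUnitary.2
  · have := h.isHermitian.spectral_theorem
    rw [Unitary.conjStarAlgAut_apply] at this
    rw [← Matrix.star_eq_conjTranspose, star_star]
    exact this

theorem existsUnique_isPseudoInverse {N : Matrix (Fin m) (Fin m) ℂ} (h : N.PosSemidef) :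
    ∃! P, IsPseudoInverse N P :=
  let ⟨P, hP⟩ := exists_isPseudoInverse h
  ⟨P, hP, fun _ h' => h'.unique hP⟩

variable {Q : ℝ → Matrix (Fin m) (Fin m) ℂ}

theorem integrable_mulVec_jost (hq : Integrable Q) {ρ : ℂ} (hρ : 0 < ρ.im) (x : Fin m → ℂ) :
    Integrable (fun t => star (jost hq ρ t *ᵥ x) ⬝ᵥ (jost hq ρ t *ᵥ x))
      (volume.restrict (Set.Ioi 0)) ∧
    star x ⬝ᵥ (jostGram hq ρ *ᵥ x) =
      ∫ t in Set.Ioi 0, star (jost hq ρ t *ᵥ x) ⬝ᵥ (jost hq ρ t *ᵥ x) := by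
  let L : Matrix (Fin m) (Fin m) ℂ →ₗ[ℂ] ℂ :=
    { toFun := fun A => star x ⬝ᵥ (A *ᵥ x)
      map_add' := fun A B => by rw [Matrix.add_mulVec, dotProduct_add]
      map_smul' := fun c A => by rw [Matrix.smul_mulVec, dotProduct_smul]; rfl }
  have e : ∀ t, L.toContinuousLinearMap (star (jost hq ρ t) * jost hq ρ t) =
      star (jost hq ρ t *ᵥ x) ⬝ᵥ (jost hq ρ t *ᵥ x) := fun t => by
    change star x ⬝ᵥ ((star (jost hq ρ t) * jost hq ρ t) *ᵥ x) = _
    rw [← Matrix.mulVec_mulVec, Matrix.dotProduct_mulVec, Matrix.star_mulVec]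
    rfl
  have hi := integrableOn_star_jost_mul_jost hq hρ hρ.le
  refine ⟨?_, ?_⟩
  · have := L.toContinuousLinearMap.integrable_comp hi
    exact this.congr (Eventually.of_forall e)
  · have := L.toContinuousLinearMap.integral_comp_comm hi
    exact this.symm.trans (integral_congr_ae (Eventually.of_forall e))

/-- The Jost solution is invertible near `+∞`, so the nonnegative quadratic form under the integral
is strictly positive on a half-line for every nonzero vector. -/
theorem posDef_jostGram (hq : Integrable Q) {ρ : ℂ} (hρ : 0 < ρ.im) :
    (jostGram hq ρ : Matrix (Fin m) (Fin m) ℂ).PosDef := by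
  refine Matrix.PosDef.of_dotProduct_mulVec_pos (star_jostGram hq ρ) fun x hx => ?_
  obtain ⟨hi, he⟩ := integrable_mulVec_jost hq hρ x
  have hnn : ∀ t, 0 ≤ (star (jost hq ρ t *ᵥ x) ⬝ᵥ (jost hq ρ t *ᵥ x)) := fun t =>
    dotProduct_star_self_nonneg _
  have hre : ∀ t, ((star (jost hq ρ t *ᵥ x) ⬝ᵥ (jost hq ρ t *ᵥ x)).re : ℂ) =
    star (jost hq ρ t *ᵥ x) ⬝ᵥ (jost hq ρ t *ᵥ x) := fun t => (Complex.eq_re_of_ofReal_le (hnn t)).symm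
  rw [he, ← integral_congr_ae (Eventually.of_forall hre), integral_complex_ofReal]
  refine Complex.zero_lt_real.mpr ?_
  have hnr : ∀ t, 0 ≤ (star (jost hq ρ t *ᵥ x) ⬝ᵥ (jost hq ρ t *ᵥ x)).re := fun t =>
    (Complex.le_def.mp (hnn t)).1
  rw [setIntegral_pos_iff_support_of_nonneg_ae (Eventually.of_forall hnr) hi.re]
  obtain ⟨a, ha⟩ := ((eventually_isUnit_jost hq ρ).and (eventually_gt_atTop 0)).exists_forall_of_atTop
  refine lt_of_lt_of_le ?_ (measure_mono (s := Set.Ioi a) fun t ht => ⟨?_, (ha t (le_of_lt ht)).2⟩)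
  · simp
  · rw [Function.mem_support]
    intro h0
    have h1 : star (jost hq ρ t *ᵥ x) ⬝ᵥ (jost hq ρ t *ᵥ x) = 0 := by rw [← hre t, h0]; rfl
    have h2 := dotProduct_star_self_eq_zero.mp h1
    exact hx ((Matrix.mulVec_injective_iff_isUnit.mpr (ha t (le_of_lt ht)).1)
      (h2.trans (Matrix.mulVec_zero _).symm))

end LinearAlgebra

/-! ### Residues and weight matrices -/

section WeightMatrices

open scoped Matrix.Norms.L2Operator ComplexConjugate ComplexOrder

variable {m : ℕ} {Q : ℝ → Matrix (Fin m) (Fin m) ℂ} (hq : Integrable Q)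

theorem coeffA_eq_transCoeff {z : ℂ} (hz : 0 < z.im) :
    coeffA Q z = transCoeff hq.comp_neg hq z := by
  have hz0 : z ≠ 0 := fun h => by simp [h] at hz
  have hc : 0 ≤ (-conj z).im := by simpa using hz.le
  have hc0 : -conj z ≠ 0 := by simpa using hz0
  have e1 : matDeriv (jostPlus Q z) 0 = jost' hq z 0 := by
    rw [jostPlus_eq hq hz.le hz0]
    exact matDeriv_eq ((isSol_jost hq hz.le hz0).hasDerivAt 0)
  have e2 : barJostMinus Q z = fun x => star (jost hq.comp_neg (-conj z) (-x)) := by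
    funext x
    rw [barJostMinus, jostMinus_eq hq hc hc0]
    rfl
  have e3 : matDeriv (barJostMinus Q z) 0 = -star (jost' hq.comp_neg (-conj z) 0) := by
    rw [e2]
    have h1 := ((isSol_jost_reflect (q := Q) hq.comp_neg (fun x => by simp) hc hc0).hasDerivAt
      0).star
    rw [matDeriv_eq h1, star_neg, neg_zero]
  rw [coeffA, if_neg hz.ne', wronskian, e1, e3, e2, jostPlus_eq hq hz.le hz0, transCoeff,
    one_div, neg_smul, ← smul_neg]
  simp only [neg_zero]
  congr 1
  noncomm_ring

theorem coeffD_eq_star_coeffA {z : ℂ} (hz : 0 < z.im) : coeffD Q z = star (coeffA Q (-conj z)) := by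
  rw [coeffD, if_neg hz.ne']
  rfl

theorem tendsto_neg_conj_punctured {ρ : ℂ} (hc : -conj ρ = ρ) :
    Tendsto (fun z : ℂ => -conj z) (𝓝[≠] ρ) (𝓝[≠] ρ) := by
  refine tendsto_nhdsWithin_iff.mpr ⟨?_, ?_⟩
  · have : Tendsto (fun z : ℂ => -conj z) (𝓝 ρ) (𝓝 (-conj ρ)) :=
      (Complex.continuous_conj.neg).tendsto ρ
    rw [hc] at this
    exact this.mono_left nhdsWithin_le_nhds
  · filter_upwards [self_mem_nhdsWithin] with z hz h
    refine hz ?_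
    have h : -conj z = ρ := h
    rw [← h] at hc
    rw [Set.mem_singleton_iff, ← h, ← hc]
    simp

/-- Since `D(z) = A(-z̄)*` and `-ρ̄ = ρ`, conjugating the factor `-z̄ - ρ` gives `-(z - ρ)`, which
accounts for the minus sign. -/
theorem IsResMinus.isResPlus {ρ : ℂ} (hρ : 0 < ρ.im) (hc : -conj ρ = ρ)
    {R : Matrix (Fin m) (Fin m) ℂ} (h : IsResMinus Q ρ R) : IsResPlus Q ρ (-star R) := by
  have h1 : Tendsto (fun z => -star ((-conj z - ρ) • (coeffA Q (-conj z))⁻¹)) (𝓝[≠] ρ)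
      (𝓝 (-star R)) :=
    (((continuous_star (R := Matrix (Fin m) (Fin m) ℂ)).tendsto R).comp
      (Tendsto.comp h (tendsto_neg_conj_punctured hc))).neg
  refine h1.congr' ?_
  have hev : ∀ᶠ z in 𝓝[≠] ρ, 0 < z.im :=
    (Complex.continuous_im.tendsto ρ |>.eventually_const_lt hρ).filter_mono nhdsWithin_le_nhds
  filter_upwards [hev] with z hz
  have e : ∀ (c : ℂ) (a : Matrix (Fin m) (Fin m) ℂ), star (c • a) = conj c • star a := star_smul
  rw [coeffD_eq_star_coeffA hz, e, ← neg_smul, Matrix.star_eq_conjTranspose,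
    Matrix.star_eq_conjTranspose, Matrix.conjTranspose_nonsing_inv]
  congr 1
  have : conj ρ = -ρ := neg_eq_iff_eq_neg.mp hc
  rw [map_sub, map_neg, Complex.conj_conj, this]
  ring

theorem IsResMinus.unique {ρ : ℂ} {R R' : Matrix (Fin m) (Fin m) ℂ} (h : IsResMinus Q ρ R)
    (h' : IsResMinus Q ρ R') : R = R' := tendsto_nhds_unique h h'

theorem IsResPlus.unique {ρ : ℂ} {R R' : Matrix (Fin m) (Fin m) ℂ} (h : IsResPlus Q ρ R)
    (h' : IsResPlus Q ρ R') : R = R' := tendsto_nhds_unique h h'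

theorem jost_mul_cancel (ρ : ℂ) {V W : Matrix (Fin m) (Fin m) ℂ}
    (h : ∀ x, jost hq ρ x * V = jost hq ρ x * W) : V = W := by
  obtain ⟨x, hx⟩ := (eventually_isUnit_jost hq ρ).exists
  exact hx.mul_left_cancel (h x)

theorem jost_reflect_mul_cancel (ρ : ℂ) {V W : Matrix (Fin m) (Fin m) ℂ}
    (h : ∀ x, jost hq.comp_neg ρ (-x) * V = jost hq.comp_neg ρ (-x) * W) : V = W :=
  jost_mul_cancel hq.comp_neg ρ fun x => by simpa using h (-x)

/-- The residue `R` of `A⁻¹`, with the matrices relating the Jost solutions at a bound state. -/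
theorem exists_boundState (hs : ∀ᵐ x, star (Q x) = Q x) {ρ : ℂ} (hρ : 0 < ρ.im)
    (hc : -conj ρ = ρ) :
    ∃ R V W : Matrix (Fin m) (Fin m) ℂ, IsResMinus Q ρ R ∧
      (∀ x, jost hq ρ x * R = jost hq.comp_neg ρ (-x) * W) ∧
      (∀ x, jost hq ρ x * V = jost hq.comp_neg ρ (-x) * star R) ∧
      (Complex.I • V).PosSemidef := by
  have hs' := ae_star_comp_neg hs
  have hrq : ∀ x, (fun x => Q (-x)) (-x) = Q x := fun x => by simp
  obtain ⟨A₁, hA₁, hrel⟩ := exists_hasDerivAt_transCoeff hq hq.comp_neg hrq hs hs' hρ hc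
  have hG := posDef_jostGram hq hρ
  have hG' := posDef_jostGram hq.comp_neg hρ
  -- If `A₁ V = A Z`, then `W* A₁ V = W* A Z = 0`, so the sum of Gram terms vanishes and
  -- definiteness gives `V = 0`.
  have hinj : ∀ V Z, transCoeff hq.comp_neg hq ρ * V = 0 →
      A₁ * V = transCoeff hq.comp_neg hq ρ * Z → V = 0 := fun V Z hV hZ => by
    obtain ⟨W, hW⟩ := exists_relation_of_transCoeff_mul_eq_zero hq hq.comp_neg hrq hs' hρ hV
    have h1 := hrel V W hW
    rw [mul_assoc, hZ, ← mul_assoc, star_mul_transCoeff_eq_zero hq hq.comp_neg hrq hs hρ hc hW,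
      zero_mul] at h1
    have h2 := (smul_eq_zero.mp h1.symm).resolve_left (neg_ne_zero.mpr Complex.I_ne_zero)
    ext i j
    have h3 : ∀ x, V *ᵥ x = 0 := fun x => by
      by_contra hx
      have p1 := hG.dotProduct_mulVec_pos hx
      have p2 := hG'.posSemidef.dotProduct_mulVec_nonneg (W *ᵥ x)
      have h4 : star x ⬝ᵥ ((star V * jostGram hq ρ * V + star W * jostGram hq.comp_neg ρ * W) *ᵥ x)
          = 0 := by rw [h2, Matrix.zero_mulVec, dotProduct_zero]
      have e : ∀ G V : Matrix (Fin m) (Fin m) ℂ, star x ⬝ᵥ ((star V * G * V) *ᵥ x) =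
          star (V *ᵥ x) ⬝ᵥ (G *ᵥ (V *ᵥ x)) := fun G V => by
        rw [← Matrix.mulVec_mulVec, ← Matrix.mulVec_mulVec, Matrix.dotProduct_mulVec,
          Matrix.star_mulVec]
        rfl
      rw [Matrix.add_mulVec, dotProduct_add, e, e] at h4
      exact (add_pos_of_pos_of_nonneg p1 p2).ne' h4
    simpa using congrFun (h3 (Pi.single j 1)) i
  obtain ⟨R, hR, hAR, hRA, hX⟩ := exists_residue hA₁ hinj
  obtain ⟨W, hW⟩ := exists_relation_of_transCoeff_mul_eq_zero hq hq.comp_neg hrq hs' hρ hAR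
  -- The adjoint of `R A = 0` is the kernel condition for the reflected problem, with `R*` in the
  -- kernel.
  obtain ⟨V, hV⟩ := exists_relation_of_transCoeff_mul_eq_zero hq.comp_neg hq (V := star R)
    (fun x => rfl) hs hρ (by
      have := congrArg star hRA
      rwa [star_mul, star_transCoeff, hc, star_zero] at this)
  have hV' : ∀ x, jost hq ρ x * V = jost hq.comp_neg ρ (-x) * star R := fun x => by
    rw [hV (-x), neg_neg]
  refine ⟨R, V, W, ?_, hW, hV', ?_⟩
  · refine Tendsto.congr' ?_ hR
    have hev : ∀ᶠ z in 𝓝[≠] ρ, 0 < z.im :=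
      (Complex.continuous_im.tendsto ρ |>.eventually_const_lt hρ).filter_mono nhdsWithin_le_nhds
    filter_upwards [hev] with z hz
    rw [coeffA_eq_transCoeff hq hz]
  -- The derivative identity for the pair `(V, R*)` has left side `R A₁ V`, which equals `V` because
  -- `V` lies in the kernel of `A`. So `iV` is a sum of two positive semidefinite matrices.
  · have h1 := hrel V (star R) hV'
    rw [star_star, hX V (transCoeff_mul_eq_zero hq hq.comp_neg hrq hs' hρ hc hV')] at h1
    have h2 : Complex.I • V = star V * jostGram hq ρ * V +
        R * jostGram hq.comp_neg ρ * star R := by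
      conv_lhs => rw [h1]
      rw [smul_smul, mul_neg, Complex.I_mul_I, neg_neg, one_smul]
    rw [h2]
    exact (hG.posSemidef.conjTranspose_mul_mul_same V).add
      (hG'.posSemidef.mul_mul_conjTranspose_same R)

theorem weight_matrices (hq : Integrable Q) (hs : ∀ᵐ x, star (Q x) = Q x) {ρ : ℂ} (hρ : 0 < ρ.im)
    (hc : -conj ρ = ρ) :
    (∃! R, IsResMinus Q ρ R) ∧ (∃! R, IsResPlus Q ρ R) ∧
      (∃! N, IsWeightMinus Q ρ N) ∧ (∃! N, IsWeightPlus Q ρ N) ∧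
      (∃! P, IsPseudoInverse (weightPlus Q ρ) P) ∧
      weightMinus Q ρ =
        resPlus Q ρ * pseudoInverse (weightPlus Q ρ) * (resPlus Q ρ)ᴴ := by
  have hρ0 : ρ ≠ 0 := fun h => by simp [h] at hρ
  obtain ⟨R, V, W, hR, hW, hV, hN⟩ := exists_boundState hq hs hρ hc
  have hR' := hR.isResPlus hρ hc
  have eR : resMinus Q ρ = R := (Classical.epsilon_spec ⟨_, hR⟩ : IsResMinus Q ρ _).unique hR
  have eR' : resPlus Q ρ = -star R :=
    (Classical.epsilon_spec ⟨_, hR'⟩ : IsResPlus Q ρ _).unique hR'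
  have eF := jostPlus_eq hq hρ.le hρ0
  have eF' := jostMinus_eq hq hρ.le hρ0
  have iI : ∀ X : Matrix (Fin m) (Fin m) ℂ, Complex.I • (-Complex.I) • X = X := fun X => by
    rw [smul_smul, mul_neg, Complex.I_mul_I, neg_neg, one_smul]
  have hM : IsWeightMinus Q ρ ((-Complex.I) • W) := fun x => by
    rw [eR, eF, eF', hW, mul_smul_comm, iI]
  have hP : IsWeightPlus Q ρ (Complex.I • V) := fun x => by
    rw [eR', eF, eF', mul_neg, ← hV, mul_smul_comm, smul_smul, Complex.I_mul_I, neg_one_smul]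
  have uM : ∀ N, IsWeightMinus Q ρ N → N = (-Complex.I) • W := fun N h =>
    jost_reflect_mul_cancel hq ρ fun x => by
      have := (h x).symm.trans (hM x)
      rw [eF'] at this
      exact smul_right_injective _ Complex.I_ne_zero this
  have uP : ∀ N, IsWeightPlus Q ρ N → N = Complex.I • V := fun N h =>
    jost_mul_cancel hq ρ fun x => by
      have := (h x).symm.trans (hP x)
      rw [eF] at this
      exact smul_right_injective _ Complex.I_ne_zero this
  have eM : weightMinus Q ρ = (-Complex.I) • W := uM _ (Classical.epsilon_spec ⟨_, hM⟩)
  have eP : weightPlus Q ρ = Complex.I • V := uP _ (Classical.epsilon_spec ⟨_, hP⟩)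
  have hPI := existsUnique_isPseudoInverse hN
  refine ⟨⟨R, hR, fun _ h => h.unique hR⟩, ⟨_, hR', fun _ h => h.unique hR'⟩, ⟨_, hM, uM⟩,
    ⟨_, hP, uP⟩, eP ▸ hPI, ?_⟩
  have hT : IsPseudoInverse (Complex.I • V) (pseudoInverse (Complex.I • V)) :=
    Classical.epsilon_spec hPI.exists
  rw [eM, eP, eR']
  set T := pseudoInverse (Complex.I • V)
  obtain ⟨t1, -, t3, t4⟩ := hT.mul_mul_eq
  simp only [smul_mul_assoc, mul_smul_comm] at t1 t3 t4
  -- With `N = iV` this is `N T N = N`, rearranged by the commutation of `N` and `T`.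
  have hVT : V * (Complex.I • (V * T)) = V := by
    rw [t4, mul_smul_comm, ← mul_assoc]
    refine smul_right_injective _ Complex.I_ne_zero ?_
    simpa only [smul_smul] using t1
  -- The relation `F₊ V = F₋ R*` carries the previous identity from `V` to `R*`. Since `N T` is
  -- self-adjoint, the adjoint says that it fixes `R`.
  have hRT : star R * (Complex.I • (V * T)) = star R :=
    jost_reflect_mul_cancel hq ρ fun x => by
      rw [← mul_assoc, ← hV, mul_assoc, hVT]
  have hRT' : (Complex.I • (V * T)) * R = R := by
    have := congrArg star hRT
    rwa [star_mul, star_star, t3] at this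
  -- After multiplication by `F₋`, both sides reduce to `-i F₊ R`.
  refine jost_reflect_mul_cancel hq ρ fun x => ?_
  rw [← Matrix.star_eq_conjTranspose, star_neg, star_star, neg_mul, neg_mul_neg, mul_smul_comm, ← hW,
    mul_assoc, ← mul_assoc, ← hV, mul_assoc, ← mul_assoc V T R, ← mul_smul_comm]
  conv_lhs => rw [← hRT']
  rw [smul_mul_assoc, smul_smul, neg_mul, Complex.I_mul_I, neg_neg, one_smul]

end WeightMatrices

end

end MatrixScattering

open MatrixScattering in
/-- The first conjunct and the `∃!` / `IsUnit` parts say that the objects in the two formulas are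
well defined. -/
theorem mainTheorem7 (m : ℕ) (Q : ℝ → Matrix (Fin m) (Fin m) ℂ)
    (hQ : ∀ᵐ x : ℝ, (Q x).IsHermitian)
    (hint : ∀ j k, Integrable (fun x : ℝ => (1 + |x|) • Q x j k) volume) :
    (∀ ρ : ℂ, 0 ≤ ρ.im → ρ ≠ 0 → (∃! F, IsJostPlus Q ρ F) ∧ (∃! F, IsJostMinus Q ρ F)) ∧
    (∀ ρ : ℝ, ρ ≠ 0 →
      (∃! p, IsLeftCoeffs Q ρ p) ∧ (∃! p, IsRightCoeffs Q ρ p) ∧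
      IsUnit (coeffA Q ρ) ∧ IsUnit (coeffD Q ρ) ∧
      scatMinus Q ρ = -((coeffD Q ρ)ᴴ * (scatPlus Q ρ)ᴴ * ((coeffD Q (-ρ))ᴴ)⁻¹)) ∧
    (∀ (τ : ℝ) (ρk : ℂ), 0 < τ → ρk = Complex.I * τ → IsEigenvalue Q (ρk ^ 2) →
      (∃! R, IsResMinus Q ρk R) ∧ (∃! R, IsResPlus Q ρk R) ∧
      (∃! N, IsWeightMinus Q ρk N) ∧ (∃! N, IsWeightPlus Q ρk N) ∧
      (∃! P, IsPseudoInverse (weightPlus Q ρk) P) ∧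
      weightMinus Q ρk =
        resPlus Q ρk * pseudoInverse (weightPlus Q ρk) * (resPlus Q ρk)ᴴ) := by
  have hq := integrable_of_weighted hint
  have hs : ∀ᵐ x, star (Q x) = Q x := hQ
  refine ⟨fun ρ hρ hρ0 => ⟨existsUnique_isJostPlus hq hρ hρ0, existsUnique_isJostMinus hq hρ hρ0⟩,
    fun ρ hρ0 => ⟨existsUnique_isLeftCoeffs hq hs hρ0, existsUnique_isRightCoeffs hq hs hρ0,
      isUnit_coeffA hq hs hρ0, isUnit_coeffD hq hs hρ0, scatMinus_eq hq hs hρ0⟩, ?_⟩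
  rintro τ ρ hτ rfl -
  exact weight_matrices hq hs (by simpa using hτ) (by simp)
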